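/- Let $\alpha,\kappa\ge 0$, $0<\beta<1$, $\eta\ge 0$ and $\gamma>\eta^2$ (hence $\gamma>0$). All functions are complex valued. For $m=1,2$ let $H^m_*(0,1)=\{w\in H^m(0,1): w(1)=0\}$, let $H^2_*(\mathbf G)$ be the space of triples $w=(w_1,w_2,w_3)$ with $w_k\in H^2_*(0,1)$ and $w_j(0)=w_k(0)$ for $j,k=1,2,3$, and let $L_2(\mathbf G)=L_2(0,1)^3$. Let $\mathscr X=H^2_*(\mathbf G)\times L_2(\mathbf G)$ be the Hilbert space of pairs $x=(w,v)$ with inner product $$(x,\tilde x)_{\mathscr X}=\sum_{k=1}^3\Big[\int_0^1 w_k''\overline{\tilde w_k''}\,ds+(\gamma-\eta^2)\int_0^1 w_k'\overline{\tilde w_k'}\,ds+\alpha\, w_k'(0)\overline{\tilde w_k'(0)}\Big]+\sum_{k=1}^3\int_0^1 v_k\overline{\tilde v_k}\,ds .$$ Let $\mathscr D(\mathcal A)$ be the set of all $x=(w,v)\in\mathscr X$ such that $w_k\in H^4(0,1)$ for $k=1,2,3$, $v\in H^2_*(\mathbf G)$, and $$w_k''(1)=0,\qquad w_k''(0)-\alpha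 w_k'(0)-\kappa v_k'(0)=0\quad(k=1,2,3),\qquad \sum_{k=1}^3\big[w_k^{(3)}(0)-(\gamma-\eta^2)w_k'(0)+\beta\eta\, v_k(0)\big]=0 ,$$ and let $\mathcal A(w,v)=\big(v,\{-w_k^{(4)}+(\gamma-\eta^2)w_k''\}_{k=1}^3\big)$ on this domain. Let $\mathcal B(w,v)=\big(0,\{-2\beta\eta\, v_k'\}_{k=1}^3\big)$ on $\mathscr D(\mathcal B)=\{(w,v)\in\mathscr X: v_k\in H^1_*(0,1),\ k=1,2,3\}$, and let $\mathcal T=\mathcal A+\mathcal B$ on $\mathscr D(\mathcal T)=\mathscr D(\mathcal A)$. Then $\mathcal T$ is the infinitesimal generator of a contractive $C_0$-semigroup $(\mathbb S(t))_{t\ge 0}$ on $\mathscr X$, and for every $x_0\in\mathscr D(\mathcal A)$ the closed-loop system $$\dot x(t)=\mathcal T x(t)\quad(t>0),\qquad x(0)=x_0,$$ has a unique solution $x\in C^1((0,\infty);\mathscr X)\cap C([0,\infty);\mathscr D(\mathcal A))$, where $\mathscr D(\mathcal A)$ carries the graph norm; it is given by $x(t)=\mathbb S(t)x_0$. -/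

import Mathlib

open MeasureTheory Set Filter Topology
open scoped ContDiff

noncomputable section
namespace PipeNetwork

/-! ### Lebesgue space and weak derivatives on the unit interval -/

/-- Lebesgue measure on `(0,1)`. -/
abbrev unitMeasure : Measure ℝ := volume.restrict (Ioo (0 : ℝ) 1)

/-- The complex Hilbert space `L₂(0,1)`. -/
abbrev L2 : Type := Lp ℂ 2 unitMeasure

/-- `φ ∈ C_c^∞(0,1)`. -/
structure IsTestFunction (φ : ℝ → ℝ) : Prop where
  contDiff : ContDiff ℝ ∞ φ
  hasCompactSupport : HasCompactSupport φ
  tsupport_subset : tsupport φ ⊆ Ioo 0 1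

/-- `g` is the weak derivative of `f` on `(0,1)`: `∫ φ' f = -∫ φ g` for all `φ ∈ C_c^∞(0,1)`. -/
def HasWeakDeriv (f g : L2) : Prop :=
  ∀ φ : ℝ → ℝ, IsTestFunction φ →
    ∫ s in Ioo (0 : ℝ) 1, deriv φ s • f s = -∫ s in Ioo (0 : ℝ) 1, φ s • g s

lemma integrable_coe (f : L2) : Integrable f unitMeasure :=
  (Lp.memLp f).integrable one_le_two

lemma IsTestFunction.deriv {φ : ℝ → ℝ} (h : IsTestFunction φ) : IsTestFunction (deriv φ) :=
  ⟨(contDiff_infty_iff_deriv.1 h.contDiff).2, h.hasCompactSupport.deriv,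
    (tsupport_deriv_subset ..).trans h.tsupport_subset⟩

lemma IsTestFunction.integrable_smul {φ : ℝ → ℝ} (h : IsTestFunction φ) {f : ℝ → ℂ}
    (hf : Integrable f unitMeasure) : Integrable (fun s => φ s • f s) unitMeasure :=
  hf.locallyIntegrable.integrable_smul_left_of_hasCompactSupport h.contDiff.continuous
    h.hasCompactSupport

lemma HasWeakDeriv.add {f g f' g' : L2} (h : HasWeakDeriv f g) (h' : HasWeakDeriv f' g') :
    HasWeakDeriv (f + f') (g + g') := by
  intro φ hφ
  have e1 : ∫ s in Ioo (0 : ℝ) 1, _root_.deriv φ s • (f + f') s =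
      ∫ s in Ioo (0 : ℝ) 1, (_root_.deriv φ s • f s + _root_.deriv φ s • f' s) := by
    refine integral_congr_ae ?_
    filter_upwards [Lp.coeFn_add f f'] with s hs
    rw [hs, Pi.add_apply, smul_add]
  have e2 : ∫ s in Ioo (0 : ℝ) 1, φ s • (g + g') s =
      ∫ s in Ioo (0 : ℝ) 1, (φ s • g s + φ s • g' s) := by
    refine integral_congr_ae ?_
    filter_upwards [Lp.coeFn_add g g'] with s hs
    rw [hs, Pi.add_apply, smul_add]
  rw [e1, e2, integral_add (hφ.deriv.integrable_smul (integrable_coe f))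
    (hφ.deriv.integrable_smul (integrable_coe f')),
    integral_add (hφ.integrable_smul (integrable_coe g))
    (hφ.integrable_smul (integrable_coe g')), h φ hφ, h' φ hφ]
  ring

lemma HasWeakDeriv.smul {f g : L2} (c : ℂ) (h : HasWeakDeriv f g) :
    HasWeakDeriv (c • f) (c • g) := by
  intro φ hφ
  have e1 : ∫ s in Ioo (0 : ℝ) 1, _root_.deriv φ s • (c • f) s =
      ∫ s in Ioo (0 : ℝ) 1, c • (_root_.deriv φ s • f s) := by
    refine integral_congr_ae ?_
    filter_upwards [Lp.coeFn_smul c f] with s hs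
    rw [hs, Pi.smul_apply, smul_comm]
  have e2 : ∫ s in Ioo (0 : ℝ) 1, φ s • (c • g) s =
      ∫ s in Ioo (0 : ℝ) 1, c • (φ s • g s) := by
    refine integral_congr_ae ?_
    filter_upwards [Lp.coeFn_smul c g] with s hs
    rw [hs, Pi.smul_apply, smul_comm]
  rw [e1, e2, integral_smul, integral_smul, h φ hφ, smul_neg]

lemma HasWeakDeriv.zero : HasWeakDeriv 0 0 := by
  intro φ _
  rw [integral_eq_zero_of_ae, integral_eq_zero_of_ae, neg_zero] <;>
  · filter_upwards [Lp.coeFn_zero ℂ 2 unitMeasure] with s hs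
    rw [hs]; simp

lemma HasWeakDeriv.unique {f g g' : L2} (h : HasWeakDeriv f g) (h' : HasWeakDeriv f g') :
    g = g' := by
  have h0 : HasWeakDeriv 0 (g - g') := by
    have := h.add (h'.smul (-1))
    simpa [sub_eq_add_neg] using this
  have key : ∀ᵐ x ∂(volume : Measure ℝ), x ∈ Ioo (0 : ℝ) 1 → (g - g' : L2) x = 0 := by
    refine isOpen_Ioo.ae_eq_zero_of_integral_contDiff_smul_eq_zero ?_ ?_
    · have : IntegrableOn (g - g' : L2) (Ioo 0 1) := integrable_coe (g - g')
      exact this.locallyIntegrableOn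
    · intro φ h1 h2 h3
      have hφ : IsTestFunction φ := ⟨h1, h2, h3⟩
      have e := h0 φ hφ
      have e0 : ∫ s in Ioo (0 : ℝ) 1, _root_.deriv φ s • (0 : L2) s = 0 := by
        refine integral_eq_zero_of_ae ?_
        filter_upwards [Lp.coeFn_zero ℂ 2 unitMeasure] with s hs
        rw [hs]; simp
      rw [e0] at e
      rw [← setIntegral_eq_integral_of_forall_compl_eq_zero (s := Ioo 0 1)]
      · simpa using e.symm
      · intro x hx
        have : φ x = 0 := image_eq_zero_of_notMem_tsupport fun hh => hx (h3 hh)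
        simp [this]
  have : g - g' = 0 := by
    refine Lp.ext ?_
    have := (ae_restrict_iff' (measurableSet_Ioo)).2 key
    filter_upwards [this, Lp.coeFn_zero ℂ 2 unitMeasure] with s hs h0
    rw [hs, h0]; rfl
  exact sub_eq_zero.1 this

/-- A function on `(0,1)` with vanishing weak derivative is constant. -/
lemma ae_const_of_integral_deriv_smul_eq_zero {f : ℝ → ℂ} (hf : Integrable f unitMeasure)
    (h : ∀ φ : ℝ → ℝ, IsTestFunction φ → ∫ s in Ioo (0 : ℝ) 1, deriv φ s • f s = 0) :
    ∃ c : ℂ, f =ᵐ[unitMeasure] fun _ => c := by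
  let b : ContDiffBump (1 / 2 : ℝ) := ⟨1 / 8, 1 / 4, by norm_num, by norm_num⟩
  set ψ₀ : ℝ → ℝ := b.normed volume with hψ₀
  have ht₀ : IsTestFunction ψ₀ := by
    refine ⟨b.contDiff_normed, b.hasCompactSupport_normed, ?_⟩
    rw [hψ₀, b.tsupport_normed_eq, Real.closedBall_eq_Icc]
    intro x hx
    have h1 := hx.1
    have h2 := hx.2
    constructor <;> norm_num [b] at * <;> linarith
  have hi₀ : ∫ x, ψ₀ x = 1 := b.integral_normed
  have hcs : ∀ ψ : ℝ → ℝ, IsTestFunction ψ → ∫ x in Ioo (0 : ℝ) 1, ψ x = ∫ x, ψ x := by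
    intro ψ hψ
    refine setIntegral_eq_integral_of_forall_compl_eq_zero fun x hx => ?_
    exact image_eq_zero_of_notMem_tsupport fun hh => hx (hψ.tsupport_subset hh)
  refine ⟨∫ s in Ioo (0 : ℝ) 1, ψ₀ s • f s, ?_⟩
  set c := ∫ s in Ioo (0 : ℝ) 1, ψ₀ s • f s with hc
  have key : ∀ᵐ x ∂(volume : Measure ℝ), x ∈ Ioo (0 : ℝ) 1 → f x - c = 0 := by
    refine isOpen_Ioo.ae_eq_zero_of_integral_contDiff_smul_eq_zero ?_ ?_
    · have : IntegrableOn (fun x => f x - c) (Ioo 0 1) := hf.sub (integrable_const c)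
      exact this.locallyIntegrableOn
    intro ψ h1 h2 h3
    have hψ : IsTestFunction ψ := ⟨h1, h2, h3⟩
    rw [← setIntegral_eq_integral_of_forall_compl_eq_zero (s := Ioo 0 1)]
    swap
    · intro x hx
      have : ψ x = 0 := image_eq_zero_of_notMem_tsupport fun hh => hx (h3 hh)
      simp [this]
    set m := ∫ x, ψ x with hm
    set χ : ℝ → ℝ := fun x => ψ x - m * ψ₀ x with hχ
    have cχ : ContDiff ℝ ∞ χ := h1.sub (contDiff_const.mul ht₀.contDiff)
    have sχ : HasCompactSupport χ := h2.sub (ht₀.hasCompactSupport.mul_left)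
    have iχ : Integrable χ := cχ.continuous.integrable_of_hasCompactSupport sχ
    have zχ : ∫ x, χ x = 0 := by
      rw [hχ, integral_sub (h1.continuous.integrable_of_hasCompactSupport h2)
        ((ht₀.contDiff.continuous.integrable_of_hasCompactSupport
          ht₀.hasCompactSupport).const_mul m), integral_const_mul, hi₀]
      simp [hm]
    have tχ : tsupport χ ⊆ Ioo 0 1 := by
      refine (tsupport_sub _ _).trans (union_subset h3 ?_)
      exact (tsupport_mul_subset_right).trans ht₀.tsupport_subset
    set φ : ℝ → ℝ := fun t => ∫ x in Iic t, χ x with hφ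
    have dφ : ∀ t, HasDerivAt φ (χ t) t := by
      intro t
      have e : φ = fun t => (∫ x in Iic 0, χ x) + ∫ x in (0 : ℝ)..t, χ x := by
        funext t
        rw [← intervalIntegral.integral_Iic_sub_Iic iχ.integrableOn iχ.integrableOn]
        simp [hφ]
      rw [e]
      exact (intervalIntegral.integral_hasDerivAt_right (iχ.intervalIntegrable)
        (cχ.continuous.stronglyMeasurableAtFilter _ _) cχ.continuous.continuousAt).const_add _
    have dφ' : deriv φ = χ := funext fun t => (dφ t).deriv
    obtain ⟨a, b', ha, hb, hab⟩ : ∃ a b' : ℝ, 0 < a ∧ b' < 1 ∧ tsupport χ ⊆ Icc a b' := by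
      have hK : IsCompact (insert (1 / 2 : ℝ) (tsupport χ)) := IsCompact.insert sχ _
      have hne : (insert (1 / 2 : ℝ) (tsupport χ)).Nonempty := insert_nonempty _ _
      have hsub : insert (1 / 2 : ℝ) (tsupport χ) ⊆ Ioo 0 1 :=
        insert_subset (by norm_num) tχ
      refine ⟨sInf _, sSup _, (hsub (hK.sInf_mem hne)).1, (hsub (hK.sSup_mem hne)).2, ?_⟩
      intro x hx
      exact ⟨csInf_le hK.bddBelow (mem_insert_of_mem _ hx),
        le_csSup hK.bddAbove (mem_insert_of_mem _ hx)⟩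
    have suppφ : tsupport φ ⊆ Icc a b' := by
      refine closure_minimal ?_ isClosed_Icc
      intro t ht
      by_contra hn
      apply ht
      have hz : ∀ x, x ∉ Icc a b' → χ x = 0 := fun x hx =>
        image_eq_zero_of_notMem_tsupport fun hh => hx (hab hh)
      by_cases hta : t < a
      · refine setIntegral_eq_zero_of_forall_eq_zero fun x hx => hz x fun hh => ?_
        exact absurd (hh.1.trans hx) (not_le.2 hta)
      · have htb : b' < t := by
          by_contra hcon
          exact hn ⟨not_lt.1 hta, not_lt.1 hcon⟩
        simp only [hφ]
        rw [setIntegral_eq_integral_of_forall_compl_eq_zero, zχ]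
        intro x hx
        refine hz x fun hh => hx (hh.2.trans htb.le)
    have tφ : IsTestFunction φ := by
      refine ⟨contDiff_infty_iff_deriv.2 ⟨fun t => (dφ t).differentiableAt, dφ' ▸ cχ⟩, ?_, ?_⟩
      · exact isCompact_Icc.of_isClosed_subset (isClosed_tsupport φ) suppφ
      · exact suppφ.trans fun x hx => ⟨ha.trans_le hx.1, hx.2.trans_lt hb⟩
    have e := h φ tφ
    rw [dφ'] at e
    have e1 : ∫ s in Ioo (0 : ℝ) 1, χ s • f s
        = (∫ s in Ioo (0 : ℝ) 1, ψ s • f s) - m * c := by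
      rw [hc, ← integral_const_mul, ← integral_sub (hψ.integrable_smul hf)
        ((ht₀.integrable_smul hf).const_mul _)]
      refine integral_congr_ae (Eventually.of_forall fun s => ?_)
      simp [hχ]; ring
    have e2 : ∫ s in Ioo (0 : ℝ) 1, ψ s • (f s - c)
        = (∫ s in Ioo (0 : ℝ) 1, ψ s • f s) - m * c := by
      have : ∫ s in Ioo (0 : ℝ) 1, ψ s • c = m * c := by
        rw [integral_smul_const, hcs ψ hψ]; simp [hm]
      rw [← this, ← integral_sub (hψ.integrable_smul hf)
        (hψ.integrable_smul (integrable_const c))]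
      simp_rw [smul_sub]
    rw [e2, ← e1, e]
  filter_upwards [(ae_restrict_iff' measurableSet_Ioo).2 key] with x hx
  exact sub_eq_zero.1 hx

lemma integral_deriv_mul_primitive {g : ℝ → ℝ} (hg : Integrable g unitMeasure)
    {φ : ℝ → ℝ} (hφ : IsTestFunction φ) :
    ∫ s in Ioo (0 : ℝ) 1, deriv φ s * ∫ r in (0 : ℝ)..s, g r
      = -∫ s in Ioo (0 : ℝ) 1, φ s * g s := by
  have hi : IntervalIntegrable g volume 0 1 := by
    rw [intervalIntegrable_iff_integrableOn_Ioo_of_le zero_le_one]; exact hg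
  have acF := hi.absolutelyContinuousOnInterval_intervalIntegral (c := 0) (by simp)
  have acφ : AbsolutelyContinuousOnInterval φ 0 1 :=
    (hφ.contDiff.of_le (by exact_mod_cast le_top)).contDiffOn.absolutelyContinuousOnInterval
  have z0 : φ 0 = 0 := image_eq_zero_of_notMem_tsupport fun hh =>
    absurd (hφ.tsupport_subset hh).1 (lt_irrefl _)
  have z1 : φ 1 = 0 := image_eq_zero_of_notMem_tsupport fun hh =>
    absurd (hφ.tsupport_subset hh).2 (lt_irrefl _)
  have e := acF.integral_mul_deriv_eq_deriv_mul acφ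
  have e' : ∫ x in (0 : ℝ)..1, deriv (fun x => ∫ v in (0 : ℝ)..x, g v) x * φ x
      = ∫ x in (0 : ℝ)..1, φ x * g x := by
    refine intervalIntegral.integral_congr_ae ?_
    filter_upwards [hi.ae_hasDerivAt_integral] with x hx hx'
    rw [(hx (uIoc_subset_uIcc hx') 0 (by simp)).deriv, mul_comm]
  rw [e', z0, z1] at e
  rw [← integral_Ioc_eq_integral_Ioo, ← integral_Ioc_eq_integral_Ioo,
    ← intervalIntegral.integral_of_le zero_le_one, ← intervalIntegral.integral_of_le zero_le_one]
  simp only [mul_zero, sub_zero, zero_sub] at e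
  rw [← e]
  simp_rw [mul_comm]

/-- A weakly differentiable class is the primitive of its weak derivative, up to a constant. -/
lemma HasWeakDeriv.exists_continuous {f g : L2} (h : HasWeakDeriv f g) :
    ∃ c : ℂ, f =ᵐ[unitMeasure] fun t => c + ∫ r in (0 : ℝ)..t, g r := by
  have hgi := integrable_coe g
  have hi : IntervalIntegrable g volume 0 1 := by
    rw [intervalIntegrable_iff_integrableOn_Ioo_of_le zero_le_one]; exact hgi
  set F : ℝ → ℂ := fun t => ∫ r in (0 : ℝ)..t, g r with hF
  have cF : ContinuousOn F (Icc 0 1) :=by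
    have := intervalIntegral.continuousOn_primitive_interval' hi (a := 0) (by simp)
    rwa [uIcc_of_le zero_le_one] at this
  have iF : Integrable F unitMeasure :=
    (cF.integrableOn_Icc).mono_set Ioo_subset_Icc_self
  have hFw : ∀ φ : ℝ → ℝ, IsTestFunction φ →
      ∫ s in Ioo (0 : ℝ) 1, _root_.deriv φ s • F s = -∫ s in Ioo (0 : ℝ) 1, φ s • g s := by
    intro φ hφ
    have hF' := hφ.deriv.integrable_smul iF
    have hG' := hφ.integrable_smul hgi
    have hFre : ∀ s ∈ Ioo (0 : ℝ) 1, (F s).re = ∫ r in (0 : ℝ)..s, (g r).re := by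
      intro s hs
      have his : IntervalIntegrable g volume 0 s :=
        hi.mono_set (by rw [uIcc_of_le hs.1.le, uIcc_of_le zero_le_one]; exact Icc_subset_Icc le_rfl hs.2.le)
      exact (intervalIntegral.intervalIntegral_re his).symm
    have hFim : ∀ s ∈ Ioo (0 : ℝ) 1, (F s).im = ∫ r in (0 : ℝ)..s, (g r).im := by
      intro s hs
      have his : IntervalIntegrable g volume 0 s :=
        hi.mono_set (by rw [uIcc_of_le hs.1.le, uIcc_of_le zero_le_one]; exact Icc_subset_Icc le_rfl hs.2.le)
      exact (intervalIntegral.intervalIntegral_im his).symm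
    apply Complex.ext
    · have e := integral_deriv_mul_primitive hgi.re hφ
      have a1 := integral_re hF'
      have a2 := integral_re hG'
      simp only [RCLike.re_to_complex, Complex.real_smul, Complex.re_ofReal_mul] at a1 a2 e
      rw [Complex.neg_re]
      simp only [Complex.real_smul]
      rw [← a1, ← a2, ← e]
      exact setIntegral_congr_fun measurableSet_Ioo fun s hs => by simp only [hFre s hs]
    · have e := integral_deriv_mul_primitive hgi.im hφ
      have a1 := integral_im hF'
      have a2 := integral_im hG'
      simp only [RCLike.im_to_complex, Complex.real_smul, Complex.im_ofReal_mul] at a1 a2 e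
      rw [Complex.neg_im]
      simp only [Complex.real_smul]
      rw [← a1, ← a2, ← e]
      exact setIntegral_congr_fun measurableSet_Ioo fun s hs => by simp only [hFim s hs]
  obtain ⟨c, hc⟩ := ae_const_of_integral_deriv_smul_eq_zero ((integrable_coe f).sub iF) (by
    intro φ hφ
    simp only [Pi.sub_apply, smul_sub]
    rw [integral_sub (hφ.deriv.integrable_smul (integrable_coe f))
      (hφ.deriv.integrable_smul iF), h φ hφ, hFw φ hφ, sub_self])
  refine ⟨c, ?_⟩
  filter_upwards [hc] with s hs
  rw [← hs, Pi.sub_apply, sub_add_cancel]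
/-! ### Boundary values, Sobolev spaces -/

open Classical in
/-- The weak derivative of `f` (the zero class if `f` has none in `L₂(0,1)`). -/
def weakDeriv (f : L2) : L2 := if h : ∃ g, HasWeakDeriv f g then h.choose else 0

/-- `u` is a representative of the class `f` that is continuous on the closed interval `[0,1]`. -/
def IsContinuousRep (f : L2) (u : ℝ → ℂ) : Prop :=
  ContinuousOn u (Icc 0 1) ∧ f =ᵐ[unitMeasure] u

open Classical in
/-- The value `f(p)` at `p ∈ [0,1]` of the continuous representative of `f`
(zero if there is none). -/
def pointValue (f : L2) (p : ℝ) : ℂ := if h : ∃ u, IsContinuousRep f u then h.choose p else 0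

/-- The classes that have a weak derivative in `V`. -/
def havingWeakDerivIn (V : Submodule ℂ L2) : Submodule ℂ L2 where
  carrier := {f | ∃ g ∈ V, HasWeakDeriv f g}
  add_mem' := fun ⟨g, hg, h⟩ ⟨g', hg', h'⟩ => ⟨g + g', add_mem hg hg', h.add h'⟩
  zero_mem' := ⟨0, zero_mem _, HasWeakDeriv.zero⟩
  smul_mem' := fun c _ ⟨g, hg, h⟩ => ⟨c • g, Submodule.smul_mem _ c hg, h.smul c⟩

/-- The Sobolev space `Hᵐ(0,1)`: `H⁰ = L₂`, and `f ∈ Hᵐ⁺¹` if `f` has a weak derivative in `Hᵐ`. -/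
def sobolev : ℕ → Submodule ℂ L2
  | 0 => ⊤
  | m + 1 => havingWeakDerivIn (sobolev m)

lemma HasWeakDeriv.weakDeriv_eq {f g : L2} (h : HasWeakDeriv f g) : weakDeriv f = g := by
  have h' : ∃ g, HasWeakDeriv f g := ⟨g, h⟩
  rw [weakDeriv, dif_pos h']
  exact h'.choose_spec.unique h

lemma IsContinuousRep.pointValue_eq {f : L2} {u : ℝ → ℂ} (h : IsContinuousRep f u) {p : ℝ}
    (hp : p ∈ Icc (0 : ℝ) 1) : pointValue f p = u p := by
  have h' : ∃ u, IsContinuousRep f u := ⟨u, h⟩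
  rw [pointValue, dif_pos h']
  have e : h'.choose =ᵐ[volume.restrict (Icc (0 : ℝ) 1)] u := by
    rw [← restrict_Ioo_eq_restrict_Icc]
    exact h'.choose_spec.2.symm.trans h.2
  exact Measure.eqOn_Icc_of_ae_eq volume zero_ne_one e h'.choose_spec.1 h.1 hp

lemma mem_sobolev_succ {m : ℕ} {f : L2} :
    f ∈ sobolev (m + 1) ↔ ∃ g ∈ sobolev m, HasWeakDeriv f g := Iff.rfl

lemma hasWeakDeriv_of_mem {m : ℕ} {f : L2} (hf : f ∈ sobolev (m + 1)) :
    HasWeakDeriv f (weakDeriv f) := by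
  obtain ⟨g, -, h⟩ := hf
  rwa [h.weakDeriv_eq]

lemma weakDeriv_mem {m : ℕ} {f : L2} (hf : f ∈ sobolev (m + 1)) : weakDeriv f ∈ sobolev m := by
  obtain ⟨g, hg, h⟩ := hf
  rwa [h.weakDeriv_eq]

lemma sobolev_succ_le : ∀ m : ℕ, sobolev (m + 1) ≤ sobolev m
  | 0 => fun _ _ => Submodule.mem_top
  | m + 1 => fun _ ⟨g, hg, h⟩ => ⟨g, sobolev_succ_le m hg, h⟩

lemma sobolev_antitone : Antitone sobolev := antitone_nat_of_succ_le sobolev_succ_le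

lemma iterate_weakDeriv_mem (n : ℕ) : ∀ {m : ℕ} {f : L2}, f ∈ sobolev (m + n) →
    weakDeriv^[n] f ∈ sobolev m := by
  induction n with
  | zero => intro m f hf; exact hf
  | succ n ih =>
    intro m f hf
    rw [Function.iterate_succ_apply]
    exact ih (weakDeriv_mem hf)

lemma weakDeriv_add {f g : L2} (hf : f ∈ sobolev 1) (hg : g ∈ sobolev 1) :
    weakDeriv (f + g) = weakDeriv f + weakDeriv g :=
  ((hasWeakDeriv_of_mem hf).add (hasWeakDeriv_of_mem hg)).weakDeriv_eq

lemma weakDeriv_smul (c : ℂ) {f : L2} (hf : f ∈ sobolev 1) :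
    weakDeriv (c • f) = c • weakDeriv f :=
  ((hasWeakDeriv_of_mem hf).smul c).weakDeriv_eq

lemma weakDeriv_zero : weakDeriv 0 = 0 := HasWeakDeriv.zero.weakDeriv_eq

lemma iterate_weakDeriv_add (n : ℕ) : ∀ {f g : L2}, f ∈ sobolev n → g ∈ sobolev n →
    weakDeriv^[n] (f + g) = weakDeriv^[n] f + weakDeriv^[n] g := by
  induction n with
  | zero => intro f g _ _; rfl
  | succ n ih =>
    intro f g hf hg
    simp only [Function.iterate_succ_apply]
    rw [weakDeriv_add (sobolev_antitone (by omega) hf) (sobolev_antitone (by omega) hg)]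
    exact ih (weakDeriv_mem hf) (weakDeriv_mem hg)

lemma iterate_weakDeriv_smul (n : ℕ) (c : ℂ) : ∀ {f : L2}, f ∈ sobolev n →
    weakDeriv^[n] (c • f) = c • weakDeriv^[n] f := by
  induction n with
  | zero => intro f _; rfl
  | succ n ih =>
    intro f hf
    simp only [Function.iterate_succ_apply]
    rw [weakDeriv_smul c (sobolev_antitone (by omega) hf)]
    exact ih (weakDeriv_mem hf)

lemma iterate_weakDeriv_zero (n : ℕ) : weakDeriv^[n] 0 = 0 :=
  Function.iterate_fixed weakDeriv_zero n

lemma exists_continuousRep {f : L2} (hf : f ∈ sobolev 1) : ∃ u, IsContinuousRep f u := by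
  obtain ⟨g, -, h⟩ := hf
  obtain ⟨c, hc⟩ := h.exists_continuous
  have hi : IntervalIntegrable g volume 0 1 := by
    rw [intervalIntegrable_iff_integrableOn_Ioo_of_le zero_le_one]; exact integrable_coe g
  refine ⟨_, continuousOn_const.add ?_, hc⟩
  have := intervalIntegral.continuousOn_primitive_interval' hi (a := 0) (by simp)
  rwa [uIcc_of_le zero_le_one] at this

lemma pointValue_add {f g : L2} (hf : f ∈ sobolev 1) (hg : g ∈ sobolev 1) {p : ℝ}
    (hp : p ∈ Icc (0 : ℝ) 1) : pointValue (f + g) p = pointValue f p + pointValue g p := by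
  obtain ⟨u, hu⟩ := exists_continuousRep hf
  obtain ⟨v, hv⟩ := exists_continuousRep hg
  have : IsContinuousRep (f + g) (u + v) :=
    ⟨hu.1.add hv.1, (Lp.coeFn_add f g).trans (hu.2.add hv.2)⟩
  rw [this.pointValue_eq hp, hu.pointValue_eq hp, hv.pointValue_eq hp, Pi.add_apply]

lemma pointValue_smul (c : ℂ) {f : L2} (hf : f ∈ sobolev 1) {p : ℝ}
    (hp : p ∈ Icc (0 : ℝ) 1) : pointValue (c • f) p = c * pointValue f p := by
  obtain ⟨u, hu⟩ := exists_continuousRep hf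
  have : IsContinuousRep (c • f) (c • u) :=
    ⟨hu.1.const_smul c, (Lp.coeFn_smul c f).trans (hu.2.const_smul c)⟩
  rw [this.pointValue_eq hp, hu.pointValue_eq hp, Pi.smul_apply, smul_eq_mul]

lemma zero_mem_unit : (0 : ℝ) ∈ Icc (0 : ℝ) 1 := ⟨le_rfl, zero_le_one⟩

lemma one_mem_unit : (1 : ℝ) ∈ Icc (0 : ℝ) 1 := ⟨zero_le_one, le_rfl⟩

lemma pointValue_zero {p : ℝ} (hp : p ∈ Icc (0 : ℝ) 1) : pointValue 0 p = 0 := by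
  have := pointValue_smul 0 (zero_mem (sobolev 1)) hp
  simpa using this

/-- A class in `H¹(0,1)` with zero weak derivative and zero value at `1` vanishes. -/
lemma eq_zero_of_weakDeriv_eq_zero {f : L2} (hf : f ∈ sobolev 1) (hd : weakDeriv f = 0)
    (h1 : pointValue f 1 = 0) : f = 0 := by
  have h := hasWeakDeriv_of_mem hf
  rw [hd] at h
  obtain ⟨c, hc⟩ := ae_const_of_integral_deriv_smul_eq_zero (integrable_coe f) (by
    intro φ hφ
    rw [h φ hφ, integral_eq_zero_of_ae, neg_zero]
    filter_upwards [Lp.coeFn_zero ℂ 2 unitMeasure] with s hs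
    rw [hs]; simp)
  have hr : IsContinuousRep f (fun _ => c) := ⟨continuousOn_const, hc⟩
  rw [hr.pointValue_eq one_mem_unit] at h1
  subst h1
  exact Lp.ext (hc.trans (Lp.coeFn_zero ℂ 2 unitMeasure).symm)

/-- `Hᵐ_*(0,1) = {w ∈ Hᵐ(0,1) : w(1) = 0}`, for `m ≥ 1`. -/
def sobolevStar (m : ℕ) : Submodule ℂ L2 where
  carrier := {w | w ∈ sobolev m ∧ w ∈ sobolev 1 ∧ pointValue w 1 = 0}
  add_mem' := fun ⟨h, h', h''⟩ ⟨k, k', k''⟩ => ⟨add_mem h k, add_mem h' k', by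
    rw [pointValue_add h' k' one_mem_unit, h'', k'', add_zero]⟩
  zero_mem' := ⟨zero_mem _, zero_mem _, pointValue_zero one_mem_unit⟩
  smul_mem' := fun c _ ⟨h, h', h''⟩ => ⟨Submodule.smul_mem _ c h, Submodule.smul_mem _ c h', by
    rw [pointValue_smul c h' one_mem_unit, h'', mul_zero]⟩

/-- `H²_*(𝐆)`: triples in `H²_*(0,1)` which are continuous at the inner vertex `s = 0`. -/
def H2StarG : Submodule ℂ (Fin 3 → L2) where
  carrier := {w | (∀ k, w k ∈ sobolevStar 2) ∧ ∀ j k, pointValue (w j) 0 = pointValue (w k) 0}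
  add_mem' := fun {u w} ⟨h, h'⟩ ⟨k, k'⟩ => ⟨fun i => add_mem (h i) (k i), fun i j => by
    simp only [Pi.add_apply]
    rw [pointValue_add (h i).2.1 (k i).2.1 zero_mem_unit,
      pointValue_add (h j).2.1 (k j).2.1 zero_mem_unit, h' i j, k' i j]⟩
  zero_mem' := ⟨fun _ => zero_mem _, fun _ _ => rfl⟩
  smul_mem' := fun c w ⟨h, h'⟩ => ⟨fun i => Submodule.smul_mem _ c (h i), fun i j => by
    simp only [Pi.smul_apply]
    rw [pointValue_smul c (h i).2.1 zero_mem_unit,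
      pointValue_smul c (h j).2.1 zero_mem_unit, h' i j]⟩

/-! ### The state space and the operators -/

/-- The parameters of the network, with the standing restrictions on them. -/
structure Params where
  α : ℝ
  β : ℝ
  γ : ℝ
  η : ℝ
  κ : ℝ
  α_nonneg : 0 ≤ α
  κ_nonneg : 0 ≤ κ
  β_pos : 0 < β
  β_lt_one : β < 1
  γ_pos : 0 < γ
  η_nonneg : 0 ≤ η
  sq_η_lt_γ : η ^ 2 < γ

/-- The state space `𝒳 = H²_*(𝐆) × L₂(𝐆)` of pairs `(w, v)`, `w = (w₁,w₂,w₃)`, `v = (v₁,v₂,v₃)`.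
It depends on the parameters through its inner product, which is defined below. -/
def StateSpace (_P : Params) : Type := ↥(H2StarG.prod (⊤ : Submodule ℂ (Fin 3 → L2)))

namespace StateSpace

variable {P : Params}

instance : AddCommGroup (StateSpace P) :=
  inferInstanceAs (AddCommGroup ↥(H2StarG.prod (⊤ : Submodule ℂ (Fin 3 → L2))))

instance : Module ℂ (StateSpace P) :=
  inferInstanceAs (Module ℂ ↥(H2StarG.prod (⊤ : Submodule ℂ (Fin 3 → L2))))

/-- The displacement component `w` of a state. -/
def w (x : StateSpace P) : Fin 3 → L2 := x.1.1

/-- The velocity component `v` of a state. -/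
def v (x : StateSpace P) : Fin 3 → L2 := x.1.2

/-- The state with components `w` and `v`. -/
def mk (w v : Fin 3 → L2) (hw : w ∈ H2StarG) : StateSpace P := ⟨(w, v), hw, Submodule.mem_top⟩

lemma ext {x y : StateSpace P} (hw : x.w = y.w) (hv : x.v = y.v) : x = y :=
  Subtype.ext (Prod.ext hw hv)

@[simp] lemma w_mk (w v : Fin 3 → L2) (hw : w ∈ H2StarG) : (mk w v hw : StateSpace P).w = w := rfl
@[simp] lemma v_mk (w v : Fin 3 → L2) (hw : w ∈ H2StarG) : (mk w v hw : StateSpace P).v = v := rfl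
@[simp] lemma w_add (x y : StateSpace P) : (x + y).w = x.w + y.w := rfl
@[simp] lemma v_add (x y : StateSpace P) : (x + y).v = x.v + y.v := rfl
@[simp] lemma w_smul (c : ℂ) (x : StateSpace P) : (c • x).w = c • x.w := rfl
@[simp] lemma v_smul (c : ℂ) (x : StateSpace P) : (c • x).v = c • x.v := rfl
@[simp] lemma w_zero : (0 : StateSpace P).w = 0 := rfl
@[simp] lemma v_zero : (0 : StateSpace P).v = 0 := rfl

lemma w_mem (x : StateSpace P) : x.w ∈ H2StarG := x.2.1

lemma w_mem_sobolev_two (x : StateSpace P) (k : Fin 3) : x.w k ∈ sobolev 2 := (x.w_mem.1 k).1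

lemma w_mem_sobolev_one (x : StateSpace P) (k : Fin 3) : x.w k ∈ sobolev 1 := (x.w_mem.1 k).2.1

lemma weakDeriv_w_mem (x : StateSpace P) (k : Fin 3) : weakDeriv (x.w k) ∈ sobolev 1 :=
  weakDeriv_mem (x.w_mem_sobolev_two k)

/-- The energy inner product
`∑ₖ [∫ w̃ₖ'' conj wₖ'' + (γ - η²) ∫ w̃ₖ' conj wₖ' + α w̃ₖ'(0) conj wₖ'(0)] + ∑ₖ ∫ ṽₖ conj vₖ`
(conjugate-linear in the first variable, as is the convention for `inner`). -/
instance : Inner ℂ (StateSpace P) where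
  inner x y :=
    ∑ k, (inner ℂ (weakDeriv^[2] (x.w k)) (weakDeriv^[2] (y.w k))
        + ((P.γ - P.η ^ 2 : ℝ) : ℂ) * inner ℂ (weakDeriv (x.w k)) (weakDeriv (y.w k))
        + (P.α : ℂ) * (pointValue (weakDeriv (y.w k)) 0
            * (starRingEnd ℂ) (pointValue (weakDeriv (x.w k)) 0)))
      + ∑ k, inner ℂ (x.v k) (y.v k)

lemma inner_def (x y : StateSpace P) : inner ℂ x y =
    ∑ k, (inner ℂ (weakDeriv^[2] (x.w k)) (weakDeriv^[2] (y.w k))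
        + ((P.γ - P.η ^ 2 : ℝ) : ℂ) * inner ℂ (weakDeriv (x.w k)) (weakDeriv (y.w k))
        + (P.α : ℂ) * (pointValue (weakDeriv (y.w k)) 0
            * (starRingEnd ℂ) (pointValue (weakDeriv (x.w k)) 0)))
      + ∑ k, inner ℂ (x.v k) (y.v k) := rfl

lemma inner_self (x : StateSpace P) : inner ℂ x x =
    ((∑ k, (‖weakDeriv^[2] (x.w k)‖ ^ 2 + (P.γ - P.η ^ 2) * ‖weakDeriv (x.w k)‖ ^ 2
        + P.α * ‖pointValue (weakDeriv (x.w k)) 0‖ ^ 2) + ∑ k, ‖x.v k‖ ^ 2 : ℝ) : ℂ) := by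
  rw [inner_def]
  push_cast
  simp only [inner_self_eq_norm_sq_to_K, Complex.mul_conj, Complex.normSq_eq_norm_sq]
  push_cast
  rfl

/-- `inner` satisfies the axioms of an inner product. -/
@[reducible] def innerCore : InnerProductSpace.Core ℂ (StateSpace P) where
  conj_inner_symm x y := by
    simp only [inner_def, map_add, map_sum, map_mul, inner_conj_symm, Complex.conj_ofReal,
      Complex.conj_conj]
    congr 1
    refine Finset.sum_congr rfl fun k _ => ?_
    ring
  re_inner_nonneg x := by
    rw [inner_self, RCLike.re_to_complex, Complex.ofReal_re]
    have h1 := P.sq_η_lt_γ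
    have h2 := P.α_nonneg
    have h3 : 0 ≤ P.γ - P.η ^ 2 := by linarith
    positivity
  add_left x y z := by
    simp only [inner_def, w_add, v_add, Pi.add_apply]
    simp only [iterate_weakDeriv_add 2 (x.w_mem_sobolev_two _) (y.w_mem_sobolev_two _),
      weakDeriv_add (x.w_mem_sobolev_one _) (y.w_mem_sobolev_one _),
      pointValue_add (x.weakDeriv_w_mem _) (y.weakDeriv_w_mem _) zero_mem_unit,
      inner_add_left, map_add, Finset.sum_add_distrib, mul_add]
    ring
  smul_left x y c := by
    simp only [inner_def, w_smul, v_smul, Pi.smul_apply]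
    simp only [iterate_weakDeriv_smul 2 c (x.w_mem_sobolev_two _),
      weakDeriv_smul c (x.w_mem_sobolev_one _),
      pointValue_smul c (x.weakDeriv_w_mem _) zero_mem_unit,
      inner_smul_left, map_mul, mul_add, Finset.mul_sum]
    congr 1
    refine Finset.sum_congr rfl fun k _ => ?_
    ring
  definite x h := by
    rw [inner_self] at h
    have h := Complex.ofReal_eq_zero.1 h
    have h1 : 0 < P.γ - P.η ^ 2 := sub_pos.2 P.sq_η_lt_γ
    have h2 := P.α_nonneg
    have n1 : ∀ k ∈ Finset.univ, 0 ≤ ‖weakDeriv^[2] (x.w k)‖ ^ 2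
        + (P.γ - P.η ^ 2) * ‖weakDeriv (x.w k)‖ ^ 2
        + P.α * ‖pointValue (weakDeriv (x.w k)) 0‖ ^ 2 := fun k _ => by positivity
    have n2 : ∀ k ∈ (Finset.univ : Finset (Fin 3)), 0 ≤ ‖x.v k‖ ^ 2 := fun k _ => by positivity
    obtain ⟨e1, e2⟩ := (add_eq_zero_iff_of_nonneg (Finset.sum_nonneg n1)
      (Finset.sum_nonneg n2)).1 h
    rw [Finset.sum_eq_zero_iff_of_nonneg n1] at e1
    rw [Finset.sum_eq_zero_iff_of_nonneg n2] at e2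
    refine ext (funext fun k => ?_) (funext fun k => ?_)
    · refine eq_zero_of_weakDeriv_eq_zero (x.w_mem_sobolev_one k) ?_ (x.w_mem.1 k).2.2
      have e := e1 k (Finset.mem_univ k)
      have a1 : 0 ≤ ‖weakDeriv^[2] (x.w k)‖ ^ 2 := by positivity
      have a2 : 0 ≤ (P.γ - P.η ^ 2) * ‖weakDeriv (x.w k)‖ ^ 2 := by positivity
      have a3 : 0 ≤ P.α * ‖pointValue (weakDeriv (x.w k)) 0‖ ^ 2 := by positivity
      have a4 : (P.γ - P.η ^ 2) * ‖weakDeriv (x.w k)‖ ^ 2 = 0 := by linarith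
      have a5 := (mul_eq_zero.1 a4).resolve_left h1.ne'
      exact norm_eq_zero.1 (pow_eq_zero_iff two_ne_zero |>.1 a5)
    · exact norm_eq_zero.1 (pow_eq_zero_iff two_ne_zero |>.1 (e2 k (Finset.mem_univ k)))

instance : NormedAddCommGroup (StateSpace P) := (innerCore (P := P)).toNormedAddCommGroup

instance : InnerProductSpace ℂ (StateSpace P) := InnerProductSpace.ofCore innerCore.toCore

end StateSpace

open StateSpace

/-- The operator `𝒜 (w, v) = (v, -w⁗ + (γ - η²) w'')`. Its domain consists of the states with
`wₖ ∈ H⁴(0,1)`, `v ∈ H²_*(𝐆)`, `wₖ''(1) = 0`, `wₖ''(0) - α wₖ'(0) - κ vₖ'(0) = 0`, and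
`∑ₖ [wₖ'''(0) - (γ - η²) wₖ'(0) + βη vₖ(0)] = 0`. The continuity `vⱼ(0) = vₖ(0)` contained in
`v ∈ H²_*(𝐆)` is what makes `𝒜 (w, v)` an element of the state space. -/
def opA (P : Params) : StateSpace P →ₗ.[ℂ] StateSpace P where
  domain :=
    { carrier := {x |
        (∀ k, x.w k ∈ sobolev 4) ∧ x.v ∈ H2StarG ∧
        (∀ k, pointValue (weakDeriv^[2] (x.w k)) 1 = 0) ∧
        (∀ k, pointValue (weakDeriv^[2] (x.w k)) 0 - P.α * pointValue (weakDeriv (x.w k)) 0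
          - P.κ * pointValue (weakDeriv (x.v k)) 0 = 0) ∧
        ∑ k, (pointValue (weakDeriv^[3] (x.w k)) 0
          - (P.γ - P.η ^ 2) * pointValue (weakDeriv (x.w k)) 0
          + P.β * P.η * pointValue (x.v k) 0) = 0}
      add_mem' := by
        rintro x y ⟨a1, a2, a3, a4, a5⟩ ⟨b1, b2, b3, b4, b5⟩
        have p2 : ∀ k, ∀ p ∈ Icc (0 : ℝ) 1, pointValue (weakDeriv^[2] (x.w k + y.w k)) p
            = pointValue (weakDeriv^[2] (x.w k)) p + pointValue (weakDeriv^[2] (y.w k)) p := by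
          intro k p hp
          rw [iterate_weakDeriv_add 2 (x.w_mem_sobolev_two k) (y.w_mem_sobolev_two k),
            pointValue_add (sobolev_antitone (by omega) (iterate_weakDeriv_mem 2 (m := 2) (a1 k)))
              (sobolev_antitone (by omega) (iterate_weakDeriv_mem 2 (m := 2) (b1 k))) hp]
        have p1 : ∀ k, pointValue (weakDeriv (x.w k + y.w k)) 0
            = pointValue (weakDeriv (x.w k)) 0 + pointValue (weakDeriv (y.w k)) 0 := by
          intro k
          rw [weakDeriv_add (x.w_mem_sobolev_one k) (y.w_mem_sobolev_one k),
            pointValue_add (x.weakDeriv_w_mem k) (y.weakDeriv_w_mem k) zero_mem_unit]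
        have q1 : ∀ k, pointValue (weakDeriv (x.v k + y.v k)) 0
            = pointValue (weakDeriv (x.v k)) 0 + pointValue (weakDeriv (y.v k)) 0 := by
          intro k
          rw [weakDeriv_add (a2.1 k).2.1 (b2.1 k).2.1,
            pointValue_add (weakDeriv_mem (a2.1 k).1) (weakDeriv_mem (b2.1 k).1) zero_mem_unit]
        have p3 : ∀ k, pointValue (weakDeriv^[3] (x.w k + y.w k)) 0
            = pointValue (weakDeriv^[3] (x.w k)) 0 + pointValue (weakDeriv^[3] (y.w k)) 0 := by
          intro k
          rw [iterate_weakDeriv_add 3 (sobolev_antitone (by omega) (a1 k))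
              (sobolev_antitone (by omega) (b1 k)),
            pointValue_add (iterate_weakDeriv_mem 3 (m := 1) (a1 k))
              (iterate_weakDeriv_mem 3 (m := 1) (b1 k)) zero_mem_unit]
        refine ⟨fun k => add_mem (a1 k) (b1 k), add_mem a2 b2, fun k => ?_, fun k => ?_, ?_⟩
        · rw [w_add, Pi.add_apply, p2 k 1 one_mem_unit, a3, b3, add_zero]
        · rw [w_add, v_add, Pi.add_apply, Pi.add_apply, p2 k 0 zero_mem_unit, p1, q1]
          linear_combination a4 k + b4 k
        · rw [← add_zero (0 : ℂ)]
          refine Eq.trans ?_ (congrArg₂ (· + ·) a5 b5)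
          rw [← Finset.sum_add_distrib]
          refine Finset.sum_congr rfl fun k _ => ?_
          rw [w_add, v_add, Pi.add_apply, Pi.add_apply, p1, p3,
            pointValue_add (a2.1 k).2.1 (b2.1 k).2.1 zero_mem_unit]
          ring
      zero_mem' := by
        refine ⟨fun k => zero_mem _, zero_mem _, fun k => ?_, fun k => ?_, ?_⟩ <;>
        simp [iterate_weakDeriv_zero, weakDeriv_zero, pointValue_zero zero_mem_unit,
          pointValue_zero one_mem_unit, -Function.iterate_succ]
      smul_mem' := by
        rintro c x ⟨a1, a2, a3, a4, a5⟩
        have p2 : ∀ k, ∀ p ∈ Icc (0 : ℝ) 1, pointValue (weakDeriv^[2] (c • x.w k)) p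
            = c * pointValue (weakDeriv^[2] (x.w k)) p := by
          intro k p hp
          rw [iterate_weakDeriv_smul 2 c (x.w_mem_sobolev_two k),
            pointValue_smul c (sobolev_antitone (by omega)
              (iterate_weakDeriv_mem 2 (m := 2) (a1 k))) hp]
        have p1 : ∀ k, pointValue (weakDeriv (c • x.w k)) 0
            = c * pointValue (weakDeriv (x.w k)) 0 := by
          intro k
          rw [weakDeriv_smul c (x.w_mem_sobolev_one k),
            pointValue_smul c (x.weakDeriv_w_mem k) zero_mem_unit]
        have q1 : ∀ k, pointValue (weakDeriv (c • x.v k)) 0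
            = c * pointValue (weakDeriv (x.v k)) 0 := by
          intro k
          rw [weakDeriv_smul c (a2.1 k).2.1,
            pointValue_smul c (weakDeriv_mem (a2.1 k).1) zero_mem_unit]
        have p3 : ∀ k, pointValue (weakDeriv^[3] (c • x.w k)) 0
            = c * pointValue (weakDeriv^[3] (x.w k)) 0 := by
          intro k
          rw [iterate_weakDeriv_smul 3 c (sobolev_antitone (by omega) (a1 k)),
            pointValue_smul c (iterate_weakDeriv_mem 3 (m := 1) (a1 k)) zero_mem_unit]
        refine ⟨fun k => Submodule.smul_mem _ c (a1 k), Submodule.smul_mem _ c a2,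
          fun k => ?_, fun k => ?_, ?_⟩
        · rw [w_smul, Pi.smul_apply, p2 k 1 one_mem_unit, a3, mul_zero]
        · rw [w_smul, v_smul, Pi.smul_apply, Pi.smul_apply, p2 k 0 zero_mem_unit, p1, q1]
          linear_combination c * a4 k
        · rw [← mul_zero c, ← a5, Finset.mul_sum]
          refine Finset.sum_congr rfl fun k _ => ?_
          rw [w_smul, v_smul, Pi.smul_apply, Pi.smul_apply, p1, p3,
            pointValue_smul c (a2.1 k).2.1 zero_mem_unit]
          ring }
  toFun :=
    { toFun := fun x => StateSpace.mk x.1.v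
        (fun k => -weakDeriv^[4] (x.1.w k)
          + ((P.γ - P.η ^ 2 : ℝ) : ℂ) • weakDeriv^[2] (x.1.w k)) x.2.2.1
      map_add' := by
        rintro ⟨x, a1, -⟩ ⟨y, b1, -⟩
        refine StateSpace.ext rfl (funext fun k => ?_)
        simp only [v_mk, v_add, Pi.add_apply, Submodule.coe_add, w_add]
        rw [iterate_weakDeriv_add 4 (a1 k) (b1 k),
          iterate_weakDeriv_add 2 (x.w_mem_sobolev_two k) (y.w_mem_sobolev_two k)]
        module
      map_smul' := by
        rintro c ⟨x, a1, -⟩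
        refine StateSpace.ext rfl (funext fun k => ?_)
        simp only [v_mk, v_smul, Pi.smul_apply, Submodule.coe_smul, w_smul, RingHom.id_apply]
        rw [iterate_weakDeriv_smul 4 c (a1 k),
          iterate_weakDeriv_smul 2 c (x.w_mem_sobolev_two k)]
        module }

/-- The operator `ℬ (w, v) = (0, -2βη v')`, with the `vₖ` in `H¹_*(0,1)`. -/
def opB (P : Params) : StateSpace P →ₗ.[ℂ] StateSpace P where
  domain :=
    { carrier := {x | ∀ k, x.v k ∈ sobolevStar 1}
      add_mem' := fun hx hy k => add_mem (hx k) (hy k)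
      zero_mem' := fun _ => zero_mem _
      smul_mem' := fun c _ hx k => Submodule.smul_mem _ c (hx k) }
  toFun :=
    { toFun := fun x => StateSpace.mk 0
        (fun k => ((-2 * P.β * P.η : ℝ) : ℂ) • weakDeriv (x.1.v k)) (zero_mem _)
      map_add' := by
        rintro ⟨x, hx⟩ ⟨y, hy⟩
        refine StateSpace.ext ?_ (funext fun k => ?_)
        · simp
        · simp only [v_mk, v_add, Pi.add_apply, Submodule.coe_add]
          rw [weakDeriv_add (hx k).2.1 (hy k).2.1, smul_add]
      map_smul' := by
        rintro c ⟨x, hx⟩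
        refine StateSpace.ext ?_ (funext fun k => ?_)
        · simp
        · simp only [v_mk, v_smul, Pi.smul_apply, Submodule.coe_smul, RingHom.id_apply]
          rw [weakDeriv_smul c (hx k).2.1, smul_comm] }

/-- The system operator `𝒯 = 𝒜 + ℬ`, on the intersection of the two domains. -/
def opT (P : Params) : StateSpace P →ₗ.[ℂ] StateSpace P := opA P + opB P

/-- `𝒟(𝒯) = 𝒟(𝒜)`. -/
lemma opT_domain (P : Params) : (opT P).domain = (opA P).domain := by
  refine inf_eq_left.2 fun x hx k => ?_
  exact ⟨(hx.2.1.1 k).2.1, (hx.2.1.1 k).2.1, (hx.2.1.1 k).2.2⟩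

lemma opT_apply_w (P : Params) (x : (opT P).domain) : (opT P x).w = x.1.v := by
  have h : opT P x = opA P ⟨x.1, x.2.1⟩ + opB P ⟨x.1, x.2.2⟩ := rfl
  rw [h, w_add]
  exact add_zero x.1.v

lemma opT_apply_v (P : Params) (x : (opT P).domain) (k : Fin 3) : (opT P x).v k =
    -weakDeriv^[4] (x.1.w k) + ((P.γ - P.η ^ 2 : ℝ) : ℂ) • weakDeriv^[2] (x.1.w k)
      + ((-2 * P.β * P.η : ℝ) : ℂ) • weakDeriv (x.1.v k) := rfl

/-! ### Semigroups and solutions -/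

section Semigroup

variable {X : Type*} [NormedAddCommGroup X] [NormedSpace ℂ X]

/-- `S`, restricted to `[0,∞)`, is a `C₀`-semigroup of bounded operators on `X`. -/
structure IsC0Semigroup (S : ℝ → X →L[ℂ] X) : Prop where
  map_zero : S 0 = ContinuousLinearMap.id ℂ X
  map_add : ∀ s t : ℝ, 0 ≤ s → 0 ≤ t → S (s + t) = (S s).comp (S t)
  tendsto_zero : ∀ x : X, Tendsto (fun t => S t x) (𝓝[>] 0) (𝓝 x)

/-- `T` is the infinitesimal generator of `S`: `x ∈ 𝒟(T)` and `T x = y` if and only if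
`(S(t)x - x)/t → y` as `t ↓ 0`. -/
def IsGenerator (S : ℝ → X →L[ℂ] X) (T : X →ₗ.[ℂ] X) : Prop :=
  ∀ x y : X, (x, y) ∈ T.graph ↔
    Tendsto (fun t : ℝ => t⁻¹ • (S t x - x)) (𝓝[>] 0) (𝓝 y)

/-- `x`, restricted to `[0,∞)`, is a solution of `ẋ(t) = T x(t)`, `x(0) = x₀`, in the class
`C¹((0,∞); X) ∩ C([0,∞); 𝒟(T))`, where `𝒟(T)` carries the graph norm. -/
structure IsSolution (T : X →ₗ.[ℂ] X) (x₀ : X) (x : ℝ → X) : Prop where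
  initial : x 0 = x₀
  mem_domain : ∀ t : ℝ, 0 ≤ t → x t ∈ T.domain
  continuousOn : ContinuousOn x (Ici 0)
  continuousOn_apply :
    Continuous fun t : Ici (0 : ℝ) => T ⟨x t, mem_domain t t.2⟩
  contDiffOn : ContDiffOn ℝ 1 x (Ioi 0)
  hasDerivAt : ∀ (t : ℝ) (ht : 0 < t), HasDerivAt x (T ⟨x t, mem_domain t ht.le⟩) t

end Semigroup

end PipeNetwork

end

/-! The operator `opT P` has a bounded inverse that can be written down without solving a
differential equation. If T(w, v) = (f, g), then v = f and -w⁗ + (γ - η²) w'' = g + 2βη f'. Testing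
this against φ and integrating by parts turns every boundary condition into part of one identity:
the energy inner product of (φ, h) with (w, v) is a bounded sesquilinear form in (φ, h) and (f, g).
Adjoints of the bounded component maps of the state space represent this form by an operator K,
namely `inverseT`. `inverseT_opT` (Green's identity) gives K T = id. `regularity_inverseT` and
`inverseT_mem_domain` recover the H⁴ regularity and the boundary conditions from the weak identity,
giving T K = id.

K is dissipative: in Re⟨y, K y⟩ the pairings of w with v cancel, the transport term 2βη w'
contributes βη |w(0)|², which the vertex term removes, and -κ ∑ |wₖ'(0)|² remains.

The rest is abstract. An injective bounded dissipative K on a Hilbert space has dense range. The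
bounded operators (K - ε)⁻¹ = T(1 - εT)⁻¹ are dissipative and commute, and (K - ε)⁻¹ K y → y as ε →
0. Their exponentials are contractions that converge strongly to a semigroup S with S(t) K y = K y +
∫₀ᵗ S(s) y ds (`exists_semigroup_of_inverse`). This formula yields the generator and the solutions;
dissipativity yields maximality and uniqueness (`exists_contractionSemigroup`). -/

noncomputable section
namespace PipeNetwork

/-! ### Integration by parts on the unit interval -/

lemma intervalIntegrable_unit {E : Type*} [NormedAddCommGroup E] {g : ℝ → E}
    (hg : Integrable g unitMeasure) : IntervalIntegrable g volume 0 1 := by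
  rw [intervalIntegrable_iff_integrableOn_Ioo_of_le zero_le_one]; exact hg

lemma intervalIntegrable_unit_of_mem {E : Type*} [NormedAddCommGroup E] {g : ℝ → E}
    (hg : Integrable g unitMeasure) {s : ℝ} (hs : s ∈ Icc (0 : ℝ) 1) :
    IntervalIntegrable g volume 0 s :=
  (intervalIntegrable_unit hg).mono_set
    (by rw [uIcc_of_le hs.1, uIcc_of_le zero_le_one]; exact Icc_subset_Icc le_rfl hs.2)

lemma integral_unit_eq {E : Type*} [NormedAddCommGroup E] [NormedSpace ℝ E] (g : ℝ → E) :
    ∫ s, g s ∂unitMeasure = ∫ s in (0 : ℝ)..1, g s := by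
  rw [intervalIntegral.integral_of_le zero_le_one, integral_Ioc_eq_integral_Ioo]

lemma continuousOn_primitive {E : Type*} [NormedAddCommGroup E] [NormedSpace ℝ E] {g : ℝ → E}
    (hg : Integrable g unitMeasure) (c : E) :
    ContinuousOn (fun t => c + ∫ r in (0 : ℝ)..t, g r) (Icc 0 1) := by
  have := intervalIntegral.continuousOn_primitive_interval' (intervalIntegrable_unit hg)
    (a := 0) (by simp)
  rw [uIcc_of_le zero_le_one] at this
  exact continuousOn_const.add this

lemma integrable_primitive_mul {g h : ℝ → ℂ} (hg : Integrable g unitMeasure)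
    (hh : Integrable h unitMeasure) (c : ℂ) :
    Integrable (fun s => (c + ∫ r in (0 : ℝ)..s, g r) * h s) unitMeasure := by
  have h1 := (intervalIntegrable_unit hh).continuousOn_mul
    (g := fun s => c + ∫ r in (0 : ℝ)..s, g r)
    (by rw [uIcc_of_le zero_le_one]; exact continuousOn_primitive hg c)
  rwa [intervalIntegrable_iff_integrableOn_Ioo_of_le zero_le_one] at h1

/-- Primitives of integrable functions are absolutely continuous and the integrand is a.e. the
derivative of their product. -/
lemma integral_primitive_mul_real {g h : ℝ → ℝ} (hg : Integrable g unitMeasure)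
    (hh : Integrable h unitMeasure) (c d : ℝ) :
    ∫ s in (0 : ℝ)..1, ((c + ∫ r in (0 : ℝ)..s, g r) * h s + (d + ∫ r in (0 : ℝ)..s, h r) * g s)
      = (c + ∫ r in (0 : ℝ)..1, g r) * (d + ∫ r in (0 : ℝ)..1, h r) - c * d := by
  have acc : ∀ (e : ℝ) {k : ℝ → ℝ}, Integrable k unitMeasure →
      AbsolutelyContinuousOnInterval (fun t => e + ∫ r in (0 : ℝ)..t, k r) 0 1 := fun e k hk =>
    AbsolutelyContinuousOnInterval.add
      (contDiff_const (n := 1)).contDiffOn.absolutelyContinuousOnInterval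
      ((intervalIntegrable_unit hk).absolutelyContinuousOnInterval_intervalIntegral (by simp))
  have e := (acc c hg).integral_deriv_mul_eq_sub (acc d hh)
  simp only [intervalIntegral.integral_same, add_zero] at e
  rw [← e]
  refine intervalIntegral.integral_congr_ae ?_
  filter_upwards [(intervalIntegrable_unit hg).ae_hasDerivAt_integral,
    (intervalIntegrable_unit hh).ae_hasDerivAt_integral] with x hx hy hx'
  rw [((hx (uIoc_subset_uIcc hx') 0 (by simp)).const_add c).deriv,
    ((hy (uIoc_subset_uIcc hx') 0 (by simp)).const_add d).deriv]
  ring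

/-- The complex case follows from the real one applied to the four products of real and imaginary
parts. -/
lemma integral_primitive_mul {g h : ℝ → ℂ} (hg : Integrable g unitMeasure)
    (hh : Integrable h unitMeasure) (c d : ℂ) :
    ∫ s, (c + ∫ r in (0 : ℝ)..s, g r) * h s ∂unitMeasure
        + ∫ s, (d + ∫ r in (0 : ℝ)..s, h r) * g s ∂unitMeasure
      = (c + ∫ r in (0 : ℝ)..1, g r) * (d + ∫ r in (0 : ℝ)..1, h r) - c * d := by
  have i1 := integrable_primitive_mul hg hh c
  have i2 := integrable_primitive_mul hh hg d
  have hre : ∀ {k : ℝ → ℂ}, Integrable k unitMeasure → ∀ s ∈ Icc (0 : ℝ) 1,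
      (∫ r in (0 : ℝ)..s, k r).re = ∫ r in (0 : ℝ)..s, (k r).re := fun hk s hs =>
    (intervalIntegral.intervalIntegral_re (intervalIntegrable_unit_of_mem hk hs)).symm
  have him : ∀ {k : ℝ → ℂ}, Integrable k unitMeasure → ∀ s ∈ Icc (0 : ℝ) 1,
      (∫ r in (0 : ℝ)..s, k r).im = ∫ r in (0 : ℝ)..s, (k r).im := fun hk s hs =>
    (intervalIntegral.intervalIntegral_im (intervalIntegrable_unit_of_mem hk hs)).symm
  have hii : ∀ {k l : ℝ → ℝ} (a b : ℝ), Integrable k unitMeasure → Integrable l unitMeasure →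
      IntervalIntegrable (fun s => (a + ∫ r in (0 : ℝ)..s, k r) * l s
        + (b + ∫ r in (0 : ℝ)..s, l r) * k s) volume 0 1 := by
    intro k l a b hk hl
    refine ((intervalIntegrable_unit hl).continuousOn_mul ?_).add
      ((intervalIntegrable_unit hk).continuousOn_mul ?_) <;>
    · rw [uIcc_of_le zero_le_one]
      exact continuousOn_primitive (by assumption) _
  have key := integral_unit_eq
    (fun s => (c + ∫ r in (0 : ℝ)..s, g r) * h s + (d + ∫ r in (0 : ℝ)..s, h r) * g s)
  rw [integral_add i1 i2] at key
  rw [key]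
  have ii := intervalIntegrable_iff_integrableOn_Ioo_of_le (zero_le_one' ℝ) |>.2 (i1.add i2)
  apply Complex.ext
  · have e1 := integral_primitive_mul_real hg.re hh.re c.re d.re
    have e2 := integral_primitive_mul_real hg.im hh.im c.im d.im
    have e3 := (intervalIntegral.intervalIntegral_re ii).symm
    simp only [RCLike.re_to_complex, RCLike.im_to_complex, Pi.add_apply] at e1 e2 e3
    rw [e3]
    simp only [Complex.sub_re, Complex.mul_re, Complex.add_re, Complex.add_im,
      hre hg 1 one_mem_unit, hre hh 1 one_mem_unit, him hg 1 one_mem_unit, him hh 1 one_mem_unit]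
    -- The real part of each boundary product is a difference of two real products; regrouping them
    -- matches two instances of the real formula.
    rw [show ∀ a b c d e f : ℝ, a * b - c * d - (e - f) = (a * b - e) - (c * d - f) by
      intros; ring, ← e1, ← e2]
    have e4 := intervalIntegral.integral_sub (hii c.re d.re hg.re hh.re)
      (hii c.im d.im hg.im hh.im)
    simp only [RCLike.re_to_complex, RCLike.im_to_complex] at e4
    rw [← e4]
    refine intervalIntegral.integral_congr fun s hs => ?_
    rw [uIcc_of_le zero_le_one] at hs
    simp only [hre hg s hs, hre hh s hs, him hg s hs, him hh s hs]
    ring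
  · have e1 := integral_primitive_mul_real hg.re hh.im c.re d.im
    have e2 := integral_primitive_mul_real hg.im hh.re c.im d.re
    have e3 := (intervalIntegral.intervalIntegral_im ii).symm
    simp only [RCLike.re_to_complex, RCLike.im_to_complex, Pi.add_apply] at e1 e2 e3
    rw [e3]
    simp only [Complex.sub_im, Complex.mul_im, Complex.add_re, Complex.add_im,
      hre hg 1 one_mem_unit, hre hh 1 one_mem_unit, him hg 1 one_mem_unit, him hh 1 one_mem_unit]
    rw [show ∀ a b c d e f : ℝ, a * b + c * d - (e + f) = (a * b - e) + (c * d - f) by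
      intros; ring, ← e1, ← e2]
    have e4 := intervalIntegral.integral_add (hii c.re d.im hg.re hh.im)
      (hii c.im d.re hg.im hh.re)
    simp only [RCLike.re_to_complex, RCLike.im_to_complex] at e4
    rw [← e4]
    refine intervalIntegral.integral_congr fun s hs => ?_
    rw [uIcc_of_le zero_le_one] at hs
    simp only [hre hg s hs, hre hh s hs, him hg s hs, him hh s hs]
    ring

lemma isContinuousRep_primitive {f g : L2} {c : ℂ}
    (h : f =ᵐ[unitMeasure] fun t => c + ∫ r in (0 : ℝ)..t, g r) :
    IsContinuousRep f fun t => c + ∫ r in (0 : ℝ)..t, g r :=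
  ⟨continuousOn_primitive (integrable_coe g) c, h⟩

lemma HasWeakDeriv.ae_eq_primitive {f g : L2} (h : HasWeakDeriv f g) :
    f =ᵐ[unitMeasure] fun t => pointValue f 0 + ∫ r in (0 : ℝ)..t, g r := by
  obtain ⟨c, hc⟩ := h.exists_continuous
  have := (isContinuousRep_primitive hc).pointValue_eq zero_mem_unit
  simp only [intervalIntegral.integral_same, add_zero] at this
  rwa [this]

lemma HasWeakDeriv.pointValue_eq {f g : L2} (h : HasWeakDeriv f g) {p : ℝ}
    (hp : p ∈ Icc (0 : ℝ) 1) :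
    pointValue f p = pointValue f 0 + ∫ r in (0 : ℝ)..p, g r :=
  (isContinuousRep_primitive h.ae_eq_primitive).pointValue_eq hp

/-- A primitive has the integrand as its weak derivative. -/
lemma hasWeakDeriv_of_ae_eq {f g : L2} {c : ℂ}
    (h : f =ᵐ[unitMeasure] fun t => c + ∫ r in (0 : ℝ)..t, g r) : HasWeakDeriv f g := by
  intro φ hφ
  have z0 : φ 0 = 0 := image_eq_zero_of_notMem_tsupport fun hh =>
    absurd (hφ.tsupport_subset hh).1 (lt_irrefl _)
  have z1 : φ 1 = 0 := image_eq_zero_of_notMem_tsupport fun hh =>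
    absurd (hφ.tsupport_subset hh).2 (lt_irrefl _)
  have cd : Continuous (_root_.deriv φ) := hφ.deriv.contDiff.continuous
  have hd : Integrable (fun s => ((_root_.deriv φ s : ℝ) : ℂ)) unitMeasure :=
    ((Complex.continuous_ofReal.comp cd).integrableOn_Icc (a := 0) (b := 1)).mono_set
      Ioo_subset_Icc_self
  have prim : ∀ s, ∫ r in (0 : ℝ)..s, ((_root_.deriv φ r : ℝ) : ℂ) = φ s := by
    intro s
    rw [intervalIntegral.integral_ofReal, intervalIntegral.integral_deriv_eq_sub
      (fun x _ => (hφ.contDiff.differentiable (by simp)).differentiableAt)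
      (cd.intervalIntegrable _ _), z0, sub_zero]
  -- Here φ is viewed as the primitive of φ' with constant 0, so both boundary terms vanish.
  have e := integral_primitive_mul (integrable_coe g) hd c 0
  simp only [prim, z1, Complex.ofReal_zero, add_zero, mul_zero, zero_add, sub_zero] at e
  rw [← add_eq_zero_iff_eq_neg, ← e]
  congr 1
  refine integral_congr_ae ?_
  filter_upwards [h] with s hs
  rw [hs, Complex.real_smul, mul_comm]

/-- Integration by parts in H¹, the source of every boundary term below. -/
lemma HasWeakDeriv.inner_add_inner {f f' g g' : L2} (hf : HasWeakDeriv f f')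
    (hg : HasWeakDeriv g g') :
    inner ℂ f g' + inner ℂ f' g = (starRingEnd ℂ) (pointValue f 1) * pointValue g 1
      - (starRingEnd ℂ) (pointValue f 0) * pointValue g 0 := by
  have hc : Integrable (fun s => (starRingEnd ℂ) (f' s)) unitMeasure :=
    (Complex.conjCLE.toContinuousLinearMap).integrable_comp (integrable_coe f')
  have e := integral_primitive_mul hc (integrable_coe g') ((starRingEnd ℂ) (pointValue f 0))
    (pointValue g 0)
  have pc : ∀ s, ∫ r in (0 : ℝ)..s, (starRingEnd ℂ) (f' r)
      = (starRingEnd ℂ) (∫ r in (0 : ℝ)..s, f' r) := by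
    intro s
    simp only [intervalIntegral, integral_conj, map_sub]
  simp only [pc, ← map_add] at e
  rw [← hf.pointValue_eq one_mem_unit, ← hg.pointValue_eq one_mem_unit] at e
  rw [← e, L2.inner_def, L2.inner_def]
  congr 1 <;> refine integral_congr_ae ?_
  · filter_upwards [hf.ae_eq_primitive] with s hs
    rw [RCLike.inner_apply, ← hs, mul_comm]
  · filter_upwards [hg.ae_eq_primitive] with s hs
    rw [RCLike.inner_apply, ← hs]

/-! ### Continuous functions as classes -/

lemma memLp_of_continuous {u : ℝ → ℂ} (hu : ContinuousOn u (Icc 0 1)) :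
    MemLp u 2 unitMeasure := by
  obtain ⟨C, hC⟩ := isCompact_Icc.exists_bound_of_continuousOn hu
  refine MemLp.of_bound ((hu.mono Ioo_subset_Icc_self).aestronglyMeasurable measurableSet_Ioo) C ?_
  filter_upwards [ae_restrict_mem measurableSet_Ioo] with s hs
  exact hC s (Ioo_subset_Icc_self hs)

/-- The class of a function which is continuous on `[0,1]`. -/
def ofContinuousOn (u : ℝ → ℂ) (hu : ContinuousOn u (Icc 0 1)) : L2 :=
  (memLp_of_continuous hu).toLp u

lemma isContinuousRep_ofContinuousOn {u : ℝ → ℂ} (hu : ContinuousOn u (Icc 0 1)) :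
    IsContinuousRep (ofContinuousOn u hu) u :=
  ⟨hu, (memLp_of_continuous hu).coeFn_toLp⟩

lemma pointValue_ofContinuousOn {u : ℝ → ℂ} (hu : ContinuousOn u (Icc 0 1)) {p : ℝ}
    (hp : p ∈ Icc (0 : ℝ) 1) : pointValue (ofContinuousOn u hu) p = u p :=
  (isContinuousRep_ofContinuousOn hu).pointValue_eq hp

lemma hasWeakDeriv_ofContinuousOn {u u' : ℝ → ℂ} (hu : ∀ s, HasDerivAt u (u' s) s)
    (hu' : Continuous u') :
    HasWeakDeriv (ofContinuousOn u (continuous_iff_continuousAt.2 fun s => (hu s).continuousAt).continuousOn)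
      (ofContinuousOn u' hu'.continuousOn) := by
  refine hasWeakDeriv_of_ae_eq (c := u 0) ?_
  filter_upwards [(isContinuousRep_ofContinuousOn (u := u)
    (continuous_iff_continuousAt.2 fun s => (hu s).continuousAt).continuousOn).2,
    ae_restrict_mem measurableSet_Ioo] with s hs hs'
  rw [hs]
  have e : ∫ r in (0 : ℝ)..s, (ofContinuousOn u' hu'.continuousOn) r
      = ∫ r in (0 : ℝ)..s, u' r := by
    have h1 := (isContinuousRep_ofContinuousOn (u := u') hu'.continuousOn).2
    rw [intervalIntegral.integral_of_le hs'.1.le, intervalIntegral.integral_of_le hs'.1.le,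
      integral_Ioc_eq_integral_Ioo, integral_Ioc_eq_integral_Ioo]
    exact integral_congr_ae (ae_restrict_of_ae_restrict_of_subset
      (Ioo_subset_Ioo le_rfl hs'.2.le) h1)
  rw [e, intervalIntegral.integral_eq_sub_of_hasDerivAt (fun x _ => hu x)
    (hu'.intervalIntegrable _ _)]
  ring

/-- Every class has a primitive with prescribed value at `0`. -/
lemma exists_hasWeakDeriv (g : L2) (c : ℂ) : ∃ f, HasWeakDeriv f g ∧ pointValue f 0 = c := by
  have h := continuousOn_primitive (integrable_coe g) c
  refine ⟨ofContinuousOn _ h, hasWeakDeriv_of_ae_eq (isContinuousRep_ofContinuousOn h).2, ?_⟩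
  rw [pointValue_ofContinuousOn h zero_mem_unit]
  simp

/-- The class of the constant function `1`. -/
def oneL2 : L2 := ofContinuousOn (fun _ => 1) continuousOn_const

/-- The class of the function `1 - s`. -/
def rampL2 : L2 := ofContinuousOn (fun s => 1 - s)
  (by fun_prop)

lemma hasWeakDeriv_oneL2 : HasWeakDeriv oneL2 0 := by
  have h := hasWeakDeriv_ofContinuousOn (u := fun _ => 1) (u' := fun _ => 0)
    (fun s => hasDerivAt_const s 1) continuous_const
  have e : ofContinuousOn (fun _ => 0) continuousOn_const = 0 := MemLp.toLp_zero _
  rwa [e] at h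

lemma hasWeakDeriv_rampL2 : HasWeakDeriv rampL2 (-oneL2) := by
  have h := hasWeakDeriv_ofContinuousOn (u := fun s => 1 - s) (u' := fun _ => -1)
    (fun s => by simpa using (Complex.ofRealCLM.hasDerivAt (x := s)).const_sub 1) continuous_const
  have e : ofContinuousOn (fun _ => -1) continuousOn_const = -oneL2 :=
    MemLp.toLp_neg (memLp_of_continuous (u := fun _ => 1) continuousOn_const)
  rwa [e] at h

lemma pointValue_oneL2 {p : ℝ} (hp : p ∈ Icc (0 : ℝ) 1) : pointValue oneL2 p = 1 :=
  pointValue_ofContinuousOn _ hp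

lemma pointValue_rampL2 {p : ℝ} (hp : p ∈ Icc (0 : ℝ) 1) : pointValue rampL2 p = 1 - p :=
  pointValue_ofContinuousOn _ hp

lemma HasWeakDeriv.inner_oneL2 {f f' : L2} (h : HasWeakDeriv f f') :
    inner ℂ oneL2 f' = pointValue f 1 - pointValue f 0 := by
  have e := hasWeakDeriv_oneL2.inner_add_inner h
  simpa [pointValue_oneL2 one_mem_unit, pointValue_oneL2 zero_mem_unit] using e

/-- The weight 1 - s vanishes at 1, so only the value at 0 survives. This makes f(0) a continuous
function of the pair (f, f') in L₂. -/
lemma HasWeakDeriv.inner_rampL2 {f f' : L2} (h : HasWeakDeriv f f') :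
    inner ℂ rampL2 f' = inner ℂ oneL2 f - pointValue f 0 := by
  have e := hasWeakDeriv_rampL2.inner_add_inner h
  simp [pointValue_rampL2 one_mem_unit, pointValue_rampL2 zero_mem_unit] at e
  linear_combination e


/-! ### Closedness of the weak derivative and a Poincaré inequality -/

lemma IsTestFunction.continuousOn_ofReal {φ : ℝ → ℝ} (h : IsTestFunction φ) :
    ContinuousOn (fun s => (φ s : ℂ)) (Icc 0 1) :=
  (Complex.continuous_ofReal.comp h.contDiff.continuous).continuousOn

lemma IsTestFunction.inner_eq {φ : ℝ → ℝ} (h : IsTestFunction φ) (f : L2) :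
    inner ℂ (ofContinuousOn _ h.continuousOn_ofReal) f = ∫ s in Ioo (0 : ℝ) 1, φ s • f s := by
  rw [L2.inner_def]
  refine integral_congr_ae ?_
  filter_upwards [(isContinuousRep_ofContinuousOn h.continuousOn_ofReal).2] with s hs
  rw [hs, RCLike.inner_apply, Complex.conj_ofReal, Complex.real_smul, mul_comm]

/-- Each side of the defining identity is an inner product with a fixed class, hence passes to L₂
limits. -/
lemma hasWeakDeriv_of_tendsto {f g : L2} {F G : ℕ → L2} (hF : Tendsto F atTop (𝓝 f))
    (hG : Tendsto G atTop (𝓝 g)) (h : ∀ n, HasWeakDeriv (F n) (G n)) : HasWeakDeriv f g := by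
  intro φ hφ
  rw [← hφ.deriv.inner_eq, ← hφ.inner_eq]
  refine tendsto_nhds_unique (tendsto_const_nhds.inner hF)
    (Tendsto.congr (fun n => ?_) (tendsto_const_nhds.inner hG).neg)
  rw [hφ.deriv.inner_eq, hφ.inner_eq, h n φ hφ]

lemma integral_norm_le (g : L2) : ∫ s, ‖g s‖ ∂unitMeasure ≤ ‖g‖ := by
  have : IsProbabilityMeasure unitMeasure := ⟨by simp [unitMeasure]⟩
  rw [integral_norm_eq_lintegral_enorm (Lp.aestronglyMeasurable g), Lp.norm_def,
    ← eLpNorm_one_eq_lintegral_enorm]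
  exact ENNReal.toReal_mono (Lp.eLpNorm_ne_top g)
    (eLpNorm_le_eLpNorm_of_exponent_le one_le_two (Lp.aestronglyMeasurable g))

lemma norm_primitive_le (g : L2) {s : ℝ} (hs : s ∈ Icc (0 : ℝ) 1) :
    ‖∫ r in (0 : ℝ)..s, g r‖ ≤ ‖g‖ := by
  refine (intervalIntegral.norm_integral_le_integral_norm hs.1).trans
    (le_trans ?_ (integral_norm_le g))
  rw [integral_unit_eq]
  exact intervalIntegral.integral_mono_interval le_rfl hs.1 hs.2
    (Eventually.of_forall fun _ => norm_nonneg _) (intervalIntegrable_unit (integrable_coe g).norm)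

/-- Since f(1) = 0, f(0) = -∫₀¹ g; both terms of f(s) = f(0) + ∫₀ˢ g are then at most ‖g‖, and (0,1)
has mass 1. -/
lemma HasWeakDeriv.norm_le {f g : L2} (h : HasWeakDeriv f g) (h1 : pointValue f 1 = 0) :
    ‖f‖ ≤ 2 * ‖g‖ := by
  have : IsProbabilityMeasure unitMeasure := ⟨by simp [unitMeasure]⟩
  have h0 : ‖pointValue f 0‖ ≤ ‖g‖ := by
    have e := h.pointValue_eq one_mem_unit
    rw [h1] at e
    rw [eq_neg_of_add_eq_zero_left e.symm, norm_neg]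
    exact norm_primitive_le g one_mem_unit
  have := Lp.norm_le_of_ae_bound (f := f) (C := 2 * ‖g‖) (by positivity) (by
    filter_upwards [h.ae_eq_primitive, ae_restrict_mem measurableSet_Ioo] with s hs hs'
    rw [hs]
    refine (norm_add_le _ _).trans ?_
    linarith [norm_primitive_le g (Ioo_subset_Icc_self hs')])
  simpa [measureUnivNNReal] using this

/-! ### The components of a state as continuous linear maps -/

namespace StateSpace

variable {P : Params}

lemma hasWeakDeriv_w (x : StateSpace P) (k : Fin 3) : HasWeakDeriv (x.w k) (weakDeriv (x.w k)) :=
  hasWeakDeriv_of_mem (x.w_mem_sobolev_one k)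

lemma hasWeakDeriv_weakDeriv_w (x : StateSpace P) (k : Fin 3) :
    HasWeakDeriv (weakDeriv (x.w k)) (weakDeriv^[2] (x.w k)) :=
  hasWeakDeriv_of_mem (x.weakDeriv_w_mem k)

lemma norm_sq_eq (x : StateSpace P) : ‖x‖ ^ 2 =
    ∑ k, (‖weakDeriv^[2] (x.w k)‖ ^ 2 + (P.γ - P.η ^ 2) * ‖weakDeriv (x.w k)‖ ^ 2
        + P.α * ‖pointValue (weakDeriv (x.w k)) 0‖ ^ 2) + ∑ k, ‖x.v k‖ ^ 2 := by
  rw [← inner_self_eq_norm_sq (𝕜 := ℂ), inner_self, RCLike.re_to_complex, Complex.ofReal_re]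

end StateSpace

open StateSpace

lemma Params.stiffness_pos (P : Params) : 0 < P.γ - P.η ^ 2 := sub_pos.2 P.sq_η_lt_γ

namespace StateSpace

variable {P : Params}

lemma single_le_norm_sq (x : StateSpace P) (k : Fin 3) :
    ‖weakDeriv^[2] (x.w k)‖ ^ 2 + (P.γ - P.η ^ 2) * ‖weakDeriv (x.w k)‖ ^ 2
        + P.α * ‖pointValue (weakDeriv (x.w k)) 0‖ ^ 2 + ‖x.v k‖ ^ 2 ≤ ‖x‖ ^ 2 := by
  have h1 := P.stiffness_pos
  have h2 := P.α_nonneg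
  rw [norm_sq_eq]
  refine add_le_add (Finset.single_le_sum (f := fun k => ‖weakDeriv^[2] (x.w k)‖ ^ 2
    + (P.γ - P.η ^ 2) * ‖weakDeriv (x.w k)‖ ^ 2 + P.α * ‖pointValue (weakDeriv (x.w k)) 0‖ ^ 2)
    (fun k _ => by positivity) (Finset.mem_univ k))
    (Finset.single_le_sum (f := fun k => ‖x.v k‖ ^ 2) (fun k _ => by positivity)
      (Finset.mem_univ k))

lemma norm_v_le (x : StateSpace P) (k : Fin 3) : ‖x.v k‖ ≤ ‖x‖ := by
  have h1 := P.stiffness_pos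
  have h2 := P.α_nonneg
  have h := single_le_norm_sq x k
  refine le_of_sq_le_sq ?_ (norm_nonneg _)
  refine le_trans ?_ h
  exact le_add_of_nonneg_left (by positivity)

lemma norm_iterate_weakDeriv_w_le (x : StateSpace P) (k : Fin 3) :
    ‖weakDeriv^[2] (x.w k)‖ ≤ ‖x‖ := by
  have h1 := P.stiffness_pos
  have h2 := P.α_nonneg
  have h := single_le_norm_sq x k
  refine le_of_sq_le_sq (le_trans ?_ h) (norm_nonneg _)
  rw [add_assoc, add_assoc]
  exact le_add_of_nonneg_right (by positivity)

lemma norm_weakDeriv_w_le (x : StateSpace P) (k : Fin 3) :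
    ‖weakDeriv (x.w k)‖ ≤ (√(P.γ - P.η ^ 2))⁻¹ * ‖x‖ := by
  have h1 := P.stiffness_pos
  have h2 := P.α_nonneg
  have h := single_le_norm_sq x k
  rw [inv_mul_eq_div, le_div_iff₀ (Real.sqrt_pos.2 h1)]
  refine le_of_sq_le_sq ?_ (norm_nonneg _)
  rw [mul_pow, Real.sq_sqrt h1.le, mul_comm]
  refine le_trans ?_ h
  rw [add_assoc]
  exact le_add_of_le_of_nonneg (le_add_of_nonneg_left (by positivity)) (by positivity)

/-- `x ↦ vₖ`. -/
def velocity (k : Fin 3) : StateSpace P →L[ℂ] L2 :=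
  LinearMap.mkContinuous ⟨⟨fun x => x.v k, fun _ _ => rfl⟩, fun _ _ => rfl⟩ 1
    fun x => by rw [one_mul]; exact norm_v_le x k

/-- `x ↦ wₖ''`. -/
def curvature (k : Fin 3) : StateSpace P →L[ℂ] L2 :=
  LinearMap.mkContinuous ⟨⟨fun x => weakDeriv^[2] (x.w k), fun x y =>
      iterate_weakDeriv_add 2 (x.w_mem_sobolev_two k) (y.w_mem_sobolev_two k)⟩,
      fun c x => iterate_weakDeriv_smul 2 c (x.w_mem_sobolev_two k)⟩ 1
    fun x => by rw [one_mul]; exact norm_iterate_weakDeriv_w_le x k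

/-- `x ↦ wₖ'`. -/
def slope (k : Fin 3) : StateSpace P →L[ℂ] L2 :=
  LinearMap.mkContinuous ⟨⟨fun x => weakDeriv (x.w k), fun x y =>
      weakDeriv_add (x.w_mem_sobolev_one k) (y.w_mem_sobolev_one k)⟩,
      fun c x => weakDeriv_smul c (x.w_mem_sobolev_one k)⟩ (√(P.γ - P.η ^ 2))⁻¹
    fun x => norm_weakDeriv_w_le x k

/-- `x ↦ wₖ`. -/
def displacement (k : Fin 3) : StateSpace P →L[ℂ] L2 :=
  LinearMap.mkContinuous ⟨⟨fun x => x.w k, fun _ _ => rfl⟩, fun _ _ => rfl⟩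
    (2 * (√(P.γ - P.η ^ 2))⁻¹) fun x => by
      have h1 := (hasWeakDeriv_w x k).norm_le (x.w_mem.1 k).2.2
      have h2 := norm_weakDeriv_w_le x k
      refine h1.trans ?_
      rw [mul_assoc]
      exact mul_le_mul_of_nonneg_left h2 zero_le_two

/-- `x ↦ wₖ(0)`. -/
def displacementZero (k : Fin 3) : StateSpace P →L[ℂ] ℂ := -(innerSL ℂ oneL2 ∘L slope k)

/-- `x ↦ wₖ'(0)`. -/
def slopeZero (k : Fin 3) : StateSpace P →L[ℂ] ℂ :=
  innerSL ℂ oneL2 ∘L slope k - innerSL ℂ rampL2 ∘L curvature k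

@[simp] lemma velocity_apply (k : Fin 3) (x : StateSpace P) : velocity k x = x.v k := rfl
@[simp] lemma curvature_apply (k : Fin 3) (x : StateSpace P) :
    curvature k x = weakDeriv^[2] (x.w k) := rfl
@[simp] lemma slope_apply (k : Fin 3) (x : StateSpace P) : slope k x = weakDeriv (x.w k) := rfl
@[simp] lemma displacement_apply (k : Fin 3) (x : StateSpace P) : displacement k x = x.w k := rfl

-- Because w(1) = 0, the value w(0) equals -∫₀¹ w', which is bounded in the energy norm.
@[simp] lemma displacementZero_apply (k : Fin 3) (x : StateSpace P) :
    displacementZero k x = pointValue (x.w k) 0 := by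
  have h := (hasWeakDeriv_w x k).inner_oneL2
  rw [(x.w_mem.1 k).2.2] at h
  change -(inner ℂ oneL2 (weakDeriv (x.w k))) = _
  rw [h]; ring

-- The formula bounds w'(0) by w' and w'' alone. The energy term α |w'(0)|² would not do, since α
-- may be 0.
@[simp] lemma slopeZero_apply (k : Fin 3) (x : StateSpace P) :
    slopeZero k x = pointValue (weakDeriv (x.w k)) 0 := by
  have h := (hasWeakDeriv_weakDeriv_w x k).inner_rampL2
  change inner ℂ oneL2 (weakDeriv (x.w k)) - inner ℂ rampL2 (weakDeriv^[2] (x.w k)) = _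
  rw [h]; ring

/-! ### Completeness of the energy space. -/

instance : CompleteSpace (StateSpace P) := by
  refine Metric.complete_of_cauchySeq_tendsto fun x hx => ?_
  have lim : ∀ A : Fin 3 → StateSpace P →L[ℂ] L2, ∃ f : Fin 3 → L2,
      ∀ k, Tendsto (fun n => A k (x n)) atTop (𝓝 (f k)) := fun A =>
    ⟨fun k => (cauchySeq_tendsto_of_complete ((A k).uniformContinuous.comp_cauchySeq hx)).choose,
      fun k =>
      (cauchySeq_tendsto_of_complete ((A k).uniformContinuous.comp_cauchySeq hx)).choose_spec⟩
  obtain ⟨w, hw⟩ := lim displacement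
  obtain ⟨w', hw'⟩ := lim slope
  obtain ⟨w'', hw''⟩ := lim curvature
  obtain ⟨v, hv⟩ := lim velocity
  have d1 : ∀ k, HasWeakDeriv (w k) (w' k) := fun k =>
    hasWeakDeriv_of_tendsto (hw k) (hw' k) fun n => hasWeakDeriv_w (x n) k
  have d2 : ∀ k, HasWeakDeriv (w' k) (w'' k) := fun k =>
    hasWeakDeriv_of_tendsto (hw' k) (hw'' k) fun n => hasWeakDeriv_weakDeriv_w (x n) k
  -- The formula for w(0) used here does not require w(1) = 0, which is not yet known for the limit.
  have p0 : ∀ k, Tendsto (fun n => pointValue ((x n).w k) 0) atTop (𝓝 (pointValue (w k) 0)) := by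
    intro k
    have e : ∀ {f g : L2}, HasWeakDeriv f g →
        pointValue f 0 = inner ℂ oneL2 f - inner ℂ rampL2 g := fun h => by
      rw [h.inner_rampL2]; ring
    rw [e (d1 k)]
    simp_rw [fun n => e (hasWeakDeriv_w (x n) k)]
    exact (tendsto_const_nhds.inner (hw k)).sub (tendsto_const_nhds.inner (hw' k))
  -- The value at 1 is ⟨1, w'⟩ + w(0), and both terms are limits of the corresponding terms of the
  -- sequence.
  have p1 : ∀ k, pointValue (w k) 1 = 0 := by
    intro k
    have h := ((tendsto_const_nhds (x := oneL2)).inner (𝕜 := ℂ) (hw' k)).add (p0 k)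
    rw [(d1 k).inner_oneL2, sub_add_cancel] at h
    refine tendsto_nhds_unique h (tendsto_const_nhds.congr fun n => ?_)
    rw [slope_apply, (hasWeakDeriv_w (x n) k).inner_oneL2, ((x n).w_mem.1 k).2.2, sub_add_cancel]
  have hmem : w ∈ H2StarG := by
    refine ⟨fun k => ⟨⟨w' k, ⟨w'' k, trivial, d2 k⟩, d1 k⟩, ⟨w' k, trivial, d1 k⟩, p1 k⟩, ?_⟩
    intro j k
    refine tendsto_nhds_unique (p0 j) ((p0 k).congr fun n => (x n).w_mem.2 k j)
  refine ⟨StateSpace.mk w v hmem, ?_⟩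
  set y : StateSpace P := StateSpace.mk w v hmem
  have e1 : ∀ k, slope k y = w' k := fun k => (d1 k).weakDeriv_eq
  have e2 : ∀ k, curvature k y = w'' k := fun k => by
    change weakDeriv (weakDeriv (w k)) = _
    rw [(d1 k).weakDeriv_eq, (d2 k).weakDeriv_eq]
  have e3 : ∀ k, velocity k y = v k := fun k => rfl
  have hs : ∀ k, Tendsto (fun n => slopeZero k (x n)) atTop (𝓝 (slopeZero k y)) := by
    intro k
    have h := ((tendsto_const_nhds (x := oneL2)).inner (𝕜 := ℂ) (hw' k)).sub
      ((tendsto_const_nhds (x := rampL2)).inner (𝕜 := ℂ) (hw'' k))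
    rw [← e1, ← e2] at h
    exact h
  rw [tendsto_iff_norm_sub_tendsto_zero]
  have nz : ∀ {E : Type} [NormedAddCommGroup E] {u : ℕ → E} {a : E},
      Tendsto u atTop (𝓝 a) → Tendsto (fun n => ‖u n - a‖ ^ 2) atTop (𝓝 0) := by
    intro E _ u a h
    simpa using (tendsto_iff_norm_sub_tendsto_zero.1 h).pow 2
  have key : Tendsto (fun n => ‖x n - y‖ ^ 2) atTop (𝓝 0) := by
    have e : ∀ n, ‖x n - y‖ ^ 2 = ∑ k, (‖curvature k (x n) - curvature k y‖ ^ 2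
        + (P.γ - P.η ^ 2) * ‖slope k (x n) - slope k y‖ ^ 2
        + P.α * ‖slopeZero k (x n) - slopeZero k y‖ ^ 2)
        + ∑ k, ‖velocity k (x n) - velocity k y‖ ^ 2 := by
      intro n
      simp only [← map_sub]
      rw [norm_sq_eq]
      simp only [curvature_apply, slope_apply, slopeZero_apply, velocity_apply]
    simp_rw [e, e1, e2, e3]
    have h0 : (0 : ℝ) = ∑ _k : Fin 3, (0 + (P.γ - P.η ^ 2) * 0 + P.α * 0)
        + ∑ _k : Fin 3, 0 := by simp
    rw [h0]
    refine (tendsto_finsetSum _ fun k _ => ((nz (hw'' k)).add ((nz (hw' k)).const_mul _)).add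
      ((nz (hs k)).const_mul _)).add (tendsto_finsetSum _ fun k _ => nz (hv k))
  have := key.sqrt
  simpa [Real.sqrt_sq] using this

end StateSpace


/-! ### Semigroups generated by inverses of bounded dissipative operators -/

section Dissipative

variable {H : Type*} [NormedAddCommGroup H] [InnerProductSpace ℂ H]

/-- A trajectory whose velocity points inwards does not increase in norm. -/
lemma norm_le_of_re_inner_nonpos {u u' : ℝ → H} (hc : ContinuousOn u (Ici 0))
    (hd : ∀ t, 0 < t → HasDerivAt u (u' t) t)
    (hn : ∀ t, 0 < t → (inner ℂ (u' t) (u t)).re ≤ 0) {t : ℝ} (ht : 0 ≤ t) : ‖u t‖ ≤ ‖u 0‖ := by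
  have hd' : ∀ t, 0 < t → HasDerivAt (fun s => (inner ℂ (u s) (u s)).re)
      ((inner ℂ (u t) (u' t) + inner ℂ (u' t) (u t)).re) t := fun t ht => by
    have h := (hd t ht).inner ℂ (hd t ht)
    exact (Complex.reCLM.hasFDerivAt.comp_hasDerivAt t h :)
  have anti : AntitoneOn (fun s => (inner ℂ (u s) (u s)).re) (Ici 0) := by
    refine antitoneOn_of_hasDerivWithinAt_nonpos (convex_Ici 0)
      (Complex.continuous_re.comp_continuousOn (hc.inner hc))
      (f' := fun t => (inner ℂ (u t) (u' t) + inner ℂ (u' t) (u t)).re) ?_ ?_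
    · intro t ht
      rw [interior_Ici] at ht
      exact (hd' t ht).hasDerivWithinAt
    · intro t ht
      rw [interior_Ici] at ht
      have h1 : (inner ℂ (u t) (u' t)).re = (inner ℂ (u' t) (u t)).re :=
        inner_re_symm (𝕜 := ℂ) _ _
      rw [Complex.add_re, h1]
      linarith [hn t ht]
  have e : ∀ s, (inner ℂ (u s) (u s)).re = ‖u s‖ ^ 2 := fun s => inner_self_eq_norm_sq (𝕜 := ℂ) _
  have := anti (mem_Ici.2 le_rfl) ht ht
  simp only [e] at this
  exact le_of_sq_le_sq this (norm_nonneg _)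

/-- Dissipativity of K makes ε - K coercive with constant ε, which drives all resolvent estimates
below. -/
lemma mul_sq_norm_le_re_inner {K : H →L[ℂ] H} (hK : ∀ y, (inner ℂ (K y) y).re ≤ 0) (ε : ℝ) (y : H) :
    ε * ‖y‖ ^ 2 ≤ (inner ℂ (((ε : ℂ) • (1 : H →L[ℂ] H) - K) y) y).re := by
  have e : (inner ℂ y y).re = ‖y‖ ^ 2 := inner_self_eq_norm_sq (𝕜 := ℂ) _
  simp only [_root_.sub_apply, _root_.smul_apply,
    one_apply_eq_self, inner_sub_left, inner_smul_left, Complex.conj_ofReal,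
    Complex.sub_re, Complex.re_ofReal_mul, e]
  linarith [hK y]

/-- The resolvent `(ε - K)⁻¹`. -/
def resolventInv (K : H →L[ℂ] H) (ε : ℝ) : H →L[ℂ] H :=
  Ring.inverse ((ε : ℂ) • (1 : H →L[ℂ] H) - K)

lemma commute_resolventInv {B K : H →L[ℂ] H} (h : Commute B K) (ε : ℝ) :
    Commute B (resolventInv K ε) := by
  have h' : Commute B ((ε : ℂ) • (1 : H →L[ℂ] H) - K) :=
    ((Commute.one_right B).smul_right _).sub_right h
  by_cases hu : IsUnit ((ε : ℂ) • (1 : H →L[ℂ] H) - K)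
  · obtain ⟨u, hu⟩ := hu
    rw [resolventInv, ← hu, Ring.inverse_unit]
    rw [← hu] at h'
    exact h'.units_inv_right
  -- `Ring.inverse` is 0 at a non-unit, so the commutation holds for every ε.
  · rw [resolventInv, Ring.inverse_non_unit _ hu]
    exact Commute.zero_right B

/-- The bounded approximation `(K - 1/(n+1))⁻¹` of `K⁻¹`. -/
def yosida (K : H →L[ℂ] H) (n : ℕ) : H →L[ℂ] H := -resolventInv K (1 / ((n : ℝ) + 1))

lemma commute_yosida (K : H →L[ℂ] H) (n : ℕ) : Commute K (yosida K n) :=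
  (commute_resolventInv (Commute.refl K) _).neg_right

lemma commute_yosida_yosida (K : H →L[ℂ] H) (m n : ℕ) : Commute (yosida K m) (yosida K n) :=
  (commute_resolventInv (commute_yosida K m).symm _).neg_right

/-! ### Exponentials of bounded dissipative operators. -/

variable [CompleteSpace H]

/-- The group `exp (tA)` generated by a bounded operator. -/
def expGroup (A : H →L[ℂ] H) (t : ℝ) : H →L[ℂ] H := NormedSpace.exp ((t : ℂ) • A)

lemma expGroup_zero (A : H →L[ℂ] H) : expGroup A 0 = 1 := by
  simp [expGroup, NormedSpace.exp_zero]

lemma expGroup_add (A : H →L[ℂ] H) (s t : ℝ) :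
    expGroup A (s + t) = expGroup A s * expGroup A t := by
  rw [expGroup, Complex.ofReal_add, add_smul]
  let _ : NormedAlgebra ℚ (H →L[ℂ] H) := NormedAlgebra.restrictScalars ℚ ℂ _
  exact NormedSpace.exp_add_of_commute (((Commute.refl A).smul_left _).smul_right _)

lemma commute_expGroup {A B : H →L[ℂ] H} (h : Commute B A) (t : ℝ) : Commute B (expGroup A t) :=
  (h.smul_right _).exp_right

lemma hasDerivAt_expGroup (A : H →L[ℂ] H) (t : ℝ) :
    HasDerivAt (expGroup A) (A * expGroup A t) t := by
  have h := (hasDerivAt_exp_smul_const' A (t : ℂ)).scomp t Complex.ofRealCLM.hasDerivAt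
  rw [Complex.ofRealCLM_apply, Complex.ofReal_one, one_smul] at h
  exact h

lemma hasDerivAt_expGroup_apply (A : H →L[ℂ] H) (x : H) (t : ℝ) :
    HasDerivAt (fun s => expGroup A s x) (A (expGroup A t x)) t :=
  (((ContinuousLinearMap.apply ℂ H x).restrictScalars ℝ).hasFDerivAt).comp_hasDerivAt t
    (hasDerivAt_expGroup A t)

lemma continuous_expGroup_apply (A : H →L[ℂ] H) (x : H) : Continuous fun s => expGroup A s x :=
  continuous_iff_continuousAt.2 fun t => (hasDerivAt_expGroup_apply A x t).continuousAt

lemma norm_expGroup_apply_le {A : H →L[ℂ] H} (hA : ∀ x, (inner ℂ (A x) x).re ≤ 0) {t : ℝ}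
    (ht : 0 ≤ t) (x : H) : ‖expGroup A t x‖ ≤ ‖x‖ := by
  have := norm_le_of_re_inner_nonpos (u := fun s => expGroup A s x)
    (continuous_expGroup_apply A x).continuousOn
    (fun t _ => hasDerivAt_expGroup_apply A x t) (fun t _ => hA _) ht
  simpa [expGroup_zero] using this

/-- The path s ↦ exp(sA) exp((t - s)B) x joins exp(tB) x to exp(tA) x. Commutation puts its
derivative in the form exp(sA) exp((t - s)B)(Ax - Bx), and both exponentials are contractions. -/
lemma norm_expGroup_sub_le {A B : H →L[ℂ] H} (hA : ∀ x, (inner ℂ (A x) x).re ≤ 0)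
    (hB : ∀ x, (inner ℂ (B x) x).re ≤ 0) (hAB : Commute A B) {t : ℝ} (ht : 0 ≤ t) (x : H) :
    ‖expGroup A t x - expGroup B t x‖ ≤ t * ‖A x - B x‖ := by
  have hd : ∀ s, HasDerivAt (fun s => expGroup A s (expGroup B (t - s) x))
      (expGroup A s (expGroup B (t - s) (A x - B x))) s := by
    intro s
    have h1 : HasDerivAt (fun s => expGroup B (t - s)) (-(B * expGroup B (t - s))) s := by
      have h := (hasDerivAt_expGroup B (t - s)).scomp s ((hasDerivAt_id s).const_sub t)
      rw [neg_one_smul] at h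
      exact h
    have h2 := (((ContinuousLinearMap.apply ℂ H x).restrictScalars ℝ).hasFDerivAt).comp_hasDerivAt s
      ((hasDerivAt_expGroup A s).mul h1)
    refine h2.congr_deriv ?_
    have c1 : A * expGroup A s = expGroup A s * A := commute_expGroup (Commute.refl A) s
    have c2 : B * expGroup B (t - s) = expGroup B (t - s) * B :=
      commute_expGroup (Commute.refl B) (t - s)
    have c3 : A * expGroup B (t - s) = expGroup B (t - s) * A := commute_expGroup hAB (t - s)
    change (A * expGroup A s * expGroup B (t - s)
      + expGroup A s * -(B * expGroup B (t - s))) x = _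
    rw [c1, c2, mul_assoc, c3]
    simp [sub_eq_add_neg]
  have := norm_image_sub_le_of_norm_deriv_le_segment' (a := 0) (b := t)
    (fun s _ => (hd s).hasDerivWithinAt) (C := ‖A x - B x‖) (fun s hs =>
      (norm_expGroup_apply_le hA hs.1 _).trans (norm_expGroup_apply_le hB (sub_nonneg.2 hs.2.le) _))
    t ⟨ht, le_rfl⟩
  simpa [expGroup_zero, mul_comm] using this

/-! ### Resolvents -/

variable {K : H →L[ℂ] H}

/-- Lax–Milgram for the coercive operator ε - K. -/
lemma isUnit_smul_one_sub (hK : ∀ y, (inner ℂ (K y) y).re ≤ 0) {ε : ℝ} (hε : 0 < ε) :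
    IsUnit ((ε : ℂ) • (1 : H →L[ℂ] H) - K) := by
  refine ContinuousLinearMap.isUnit_of_forall_le_norm_inner_map _ (c := ⟨ε, hε.le⟩) hε fun x => ?_
  refine le_trans ?_ (Complex.re_le_norm _)
  rw [mul_comm]
  exact mul_sq_norm_le_re_inner hK ε x

lemma resolventInv_sub (hK : ∀ y, (inner ℂ (K y) y).re ≤ 0) {ε : ℝ} (hε : 0 < ε) (y : H) :
    resolventInv K ε (((ε : ℂ) • y) - K y) = y :=
  DFunLike.congr_fun (Ring.inverse_mul_cancel _ (isUnit_smul_one_sub hK hε)) y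

lemma sub_resolventInv (hK : ∀ y, (inner ℂ (K y) y).re ≤ 0) {ε : ℝ} (hε : 0 < ε) (y : H) :
    (ε : ℂ) • resolventInv K ε y - K (resolventInv K ε y) = y :=
  DFunLike.congr_fun (Ring.mul_inverse_cancel _ (isUnit_smul_one_sub hK hε)) y

/-- With z = (ε - K)⁻¹ y, coercivity reads ε ‖z‖² ≤ Re⟨y, z⟩ ≤ ‖y‖ ‖z‖. -/
lemma norm_smul_resolventInv_le (hK : ∀ y, (inner ℂ (K y) y).re ≤ 0) {ε : ℝ} (hε : 0 < ε)
    (y : H) : ‖(ε : ℂ) • resolventInv K ε y‖ ≤ ‖y‖ := by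
  set z := resolventInv K ε y
  have h1 := mul_sq_norm_le_re_inner hK ε z
  have h2 : ((ε : ℂ) • (1 : H →L[ℂ] H) - K) z = y := sub_resolventInv hK hε y
  rw [h2] at h1
  have h3 : (inner ℂ y z).re ≤ ‖y‖ * ‖z‖ := re_inner_le_norm (𝕜 := ℂ) y z
  rw [norm_smul, Complex.norm_real, Real.norm_of_nonneg hε.le]
  by_cases hz : ‖z‖ = 0
  · rw [hz, mul_zero]; exact norm_nonneg _
  · have : 0 < ‖z‖ := lt_of_le_of_ne (norm_nonneg _) (Ne.symm hz)
    nlinarith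

/-- If z is orthogonal to the range, the quadratic form of K at z + tu is t Re⟨Kz, u⟩ + t² Re⟨Ku,
u⟩. Being nonpositive for small t > 0, it forces Re⟨Kz, u⟩ ≤ 0; the choice u = Kz gives Kz = 0,
hence z = 0. -/
lemma denseRange_of_dissipative (hK : ∀ y, (inner ℂ (K y) y).re ≤ 0)
    (hinj : Function.Injective K) : DenseRange K := by
  have hbot : (LinearMap.range K.toLinearMap)ᗮ = ⊥ := by
    rw [Submodule.eq_bot_iff]
    intro z hz
    have hz' : ∀ u, inner ℂ (K u) z = 0 := fun u => hz _ ⟨u, rfl⟩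
    have key : ∀ u, (inner ℂ (K z) u).re ≤ 0 := by
      intro u
      by_contra hpos
      push Not at hpos
      set a := (inner ℂ (K z) u).re
      set b := (inner ℂ (K u) u).re
      have hb : b ≤ 0 := hK u
      have hq : ∀ t : ℝ, t * a + t ^ 2 * b ≤ 0 := by
        intro t
        have h := hK (z + (t : ℂ) • u)
        simp only [map_add, map_smul, inner_add_left, inner_add_right, inner_smul_left,
          inner_smul_right, hz', Complex.conj_ofReal, Complex.add_re, Complex.re_ofReal_mul,
          mul_zero, add_zero, zero_add] at h
        calc t * a + t ^ 2 * b = _ := by ring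
          _ ≤ 0 := h
      -- This t makes the quadratic expression equal to the positive number a² / (1 - b)².
      have h := hq (a / (1 - b))
      have hb' : 0 < 1 - b := by linarith
      have e : a / (1 - b) * a + (a / (1 - b)) ^ 2 * b = a ^ 2 / (1 - b) ^ 2 := by
        field_simp; ring
      rw [e] at h
      exact absurd h (not_le.2 (by positivity))
    have h0 := key (K z)
    have e : (inner ℂ (K z) (K z)).re = ‖K z‖ ^ 2 := inner_self_eq_norm_sq (𝕜 := ℂ) _
    rw [e] at h0
    have : K z = 0 := norm_eq_zero.1 (pow_eq_zero_iff two_ne_zero |>.1 (le_antisymm h0 (sq_nonneg _)))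
    exact hinj (this.trans (map_zero K).symm)
  have := (Submodule.topologicalClosure_eq_top_iff (K := LinearMap.range K.toLinearMap)).2 hbot
  exact (Submodule.dense_iff_topologicalClosure_eq_top).2 this

/-- On the range of K, ε(ε - K)⁻¹ K z = ε(ε(ε - K)⁻¹ z - z) has norm at most 2ε ‖z‖. Density of the
range and the uniform bound ‖ε(ε - K)⁻¹‖ ≤ 1 do the rest. -/
lemma tendsto_smul_resolventInv (hK : ∀ y, (inner ℂ (K y) y).re ≤ 0)
    (hinj : Function.Injective K) {ε : ℕ → ℝ} (hε : ∀ n, 0 < ε n)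
    (hlim : Tendsto ε atTop (𝓝 0)) (y : H) :
    Tendsto (fun n => (ε n : ℂ) • resolventInv K (ε n) y) atTop (𝓝 0) := by
  rw [Metric.tendsto_atTop]
  intro r hr
  obtain ⟨z, hz⟩ := (denseRange_of_dissipative hK hinj).exists_dist_lt y (half_pos hr)
  have h2 : Tendsto (fun n => ε n * (2 * ‖z‖)) atTop (𝓝 0) := by
    simpa using hlim.mul_const (2 * ‖z‖)
  obtain ⟨N, hN⟩ := (Metric.tendsto_atTop.1 h2) _ (half_pos hr)
  refine ⟨N, fun n hn => ?_⟩
  have h3 := (le_abs_self _).trans_lt ((Real.dist_0_eq_abs _) ▸ hN n hn)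
  have h4 : ‖(ε n : ℂ) • resolventInv K (ε n) (K z)‖ ≤ ε n * (2 * ‖z‖) := by
    have e : resolventInv K (ε n) (K z) = (ε n : ℂ) • resolventInv K (ε n) z - z := by
      have := resolventInv_sub hK (hε n) z
      rw [map_sub, map_smul] at this
      rw [← sub_eq_iff_eq_add'.2 (sub_eq_iff_eq_add.1 this)]
    rw [e, norm_smul, Complex.norm_real, Real.norm_of_nonneg (hε n).le]
    refine mul_le_mul_of_nonneg_left ?_ (hε n).le
    refine (norm_sub_le _ _).trans ?_
    linarith [norm_smul_resolventInv_le hK (hε n) z]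
  have h5 := norm_smul_resolventInv_le hK (hε n) (y - K z)
  rw [dist_zero_right]
  have e : (ε n : ℂ) • resolventInv K (ε n) y = (ε n : ℂ) • resolventInv K (ε n) (y - K z)
      + (ε n : ℂ) • resolventInv K (ε n) (K z) := by
    rw [map_sub, smul_sub, sub_add_cancel]
  rw [e]
  refine (norm_add_le _ _).trans_lt ?_
  rw [dist_eq_norm] at hz
  linarith

/-! ### The Yosida approximation and its limit -/

lemma re_inner_yosida_le (hK : ∀ y, (inner ℂ (K y) y).re ≤ 0) (n : ℕ) (y : H) :
    (inner ℂ (yosida K n y) y).re ≤ 0 := by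
  have hε : (0 : ℝ) < 1 / ((n : ℝ) + 1) := by positivity
  have h := mul_sq_norm_le_re_inner hK (1 / ((n : ℝ) + 1)) (resolventInv K (1 / ((n : ℝ) + 1)) y)
  have h2 : (((1 / ((n : ℝ) + 1) : ℝ) : ℂ) • (1 : H →L[ℂ] H) - K)
    (resolventInv K (1 / ((n : ℝ) + 1)) y) = y := sub_resolventInv hK hε y
  rw [h2] at h
  have h1 : (inner ℂ y (resolventInv K (1 / ((n : ℝ) + 1)) y)).re
      = (inner ℂ (resolventInv K (1 / ((n : ℝ) + 1)) y) y).re := inner_re_symm (𝕜 := ℂ) _ _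
  rw [yosida, _root_.neg_apply, inner_neg_left, Complex.neg_re, ← h1]
  have : 0 ≤ 1 / ((n : ℝ) + 1) * ‖resolventInv K (1 / ((n : ℝ) + 1)) y‖ ^ 2 := by positivity
  linarith

/-- Follows from -(ε - K)⁻¹ K y = y - ε(ε - K)⁻¹ y: the approximations converge to K⁻¹ on the range
of K. -/
lemma tendsto_yosida (hK : ∀ y, (inner ℂ (K y) y).re ≤ 0) (hinj : Function.Injective K) (y : H) :
    Tendsto (fun n => yosida K n (K y)) atTop (𝓝 y) := by
  have h := tendsto_smul_resolventInv hK hinj (ε := fun n : ℕ => 1 / ((n : ℝ) + 1))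
    (fun n => by positivity) tendsto_one_div_add_atTop_nhds_zero_nat y
  have h' := h.const_sub y
  rw [sub_zero] at h'
  refine h'.congr fun n => ?_
  have := resolventInv_sub hK (ε := 1 / ((n : ℝ) + 1)) (by positivity) y
  rw [map_sub, map_smul] at this
  rw [yosida, _root_.neg_apply]
  nth_rewrite 1 [← this]
  abel

/-- On the range of K, the distance of two exponentials is at most t times the distance of their
generators, which converge there. Density and contractivity extend this to all x. -/
lemma cauchySeq_expGroup_yosida (hK : ∀ y, (inner ℂ (K y) y).re ≤ 0)
    (hinj : Function.Injective K) {t : ℝ} (ht : 0 ≤ t) (x : H) :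
    CauchySeq fun n => expGroup (yosida K n) t x := by
  have hA := re_inner_yosida_le hK
  rw [Metric.cauchySeq_iff']
  intro r hr
  obtain ⟨z, hz⟩ :=
    (denseRange_of_dissipative hK hinj).exists_dist_lt x (show 0 < r / 4 by positivity)
  -- The factor t + 1 replaces t to allow t = 0. The three errors below are each at most r/4.
  obtain ⟨N, hN⟩ := Metric.cauchySeq_iff'.1 (tendsto_yosida hK hinj z).cauchySeq
    (r / (4 * (t + 1))) (by positivity)
  refine ⟨N, fun n hn => ?_⟩
  have h1 := norm_expGroup_sub_le (hA n) (hA N) (commute_yosida_yosida K n N) ht (K z)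
  have h2 := hN n hn
  rw [dist_eq_norm] at h2 hz
  have h3 : t * ‖yosida K n (K z) - yosida K N (K z)‖ ≤ r / 4 := by
    calc t * ‖yosida K n (K z) - yosida K N (K z)‖ ≤ (t + 1) * (r / (4 * (t + 1))) :=
          mul_le_mul (by linarith) h2.le (norm_nonneg _) (by linarith)
      _ = r / 4 := by field_simp
  have h4 := norm_expGroup_apply_le (hA n) ht (x - K z)
  have h5 := norm_expGroup_apply_le (hA N) ht (x - K z)
  have e : expGroup (yosida K n) t x - expGroup (yosida K N) t x
      = expGroup (yosida K n) t (x - K z) - expGroup (yosida K N) t (x - K z)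
        + (expGroup (yosida K n) t (K z) - expGroup (yosida K N) t (K z)) := by
    rw [map_sub, map_sub]; abel
  rw [dist_eq_norm, e]
  have h6 := norm_add_le (expGroup (yosida K n) t (x - K z) - expGroup (yosida K N) t (x - K z))
    (expGroup (yosida K n) t (K z) - expGroup (yosida K N) t (K z))
  have h7 := norm_sub_le (expGroup (yosida K n) t (x - K z)) (expGroup (yosida K N) t (x - K z))
  linarith

lemma exists_limit_expGroup (hK : ∀ y, (inner ℂ (K y) y).re ≤ 0) (hinj : Function.Injective K) :
    -- Times are cut off at 0, so that S is the identity for t ≤ 0 and its orbits are continuous on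
    -- the whole line.
    ∃ S : ℝ → H →L[ℂ] H, ∀ t, ∀ x,
      Tendsto (fun n => expGroup (yosida K n) (max t 0) x) atTop (𝓝 (S t x)) := by
  choose f hf using fun (t : ℝ) (x : H) =>
    cauchySeq_tendsto_of_complete (cauchySeq_expGroup_yosida hK hinj (le_max_right t 0) x)
  exact ⟨fun t => continuousLinearMapOfTendsto (fun n => expGroup (yosida K n) (max t 0))
    (tendsto_pi_nhds.2 (hf t)), hf⟩

/-- An injective bounded dissipative operator `K` on a Hilbert space is the inverse of the
generator of a contraction semigroup. -/
theorem exists_semigroup_of_inverse (hK : ∀ y, (inner ℂ (K y) y).re ≤ 0)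
    (hinj : Function.Injective K) :
    ∃ S : ℝ → H →L[ℂ] H, (∀ t ≤ 0, S t = 1) ∧
      (∀ s t, 0 ≤ s → 0 ≤ t → S (s + t) = (S s).comp (S t)) ∧ (∀ t x, ‖S t x‖ ≤ ‖x‖) ∧
      (∀ x, Continuous fun t => S t x) ∧ (∀ t y, S t (K y) = K (S t y)) ∧
      ∀ y t, 0 ≤ t → S t (K y) = K y + ∫ s in (0 : ℝ)..t, S s y := by
  obtain ⟨S, hS⟩ := exists_limit_expGroup hK hinj
  have hA := re_inner_yosida_le hK
  have hSn : ∀ t x, ‖S t x‖ ≤ ‖x‖ := fun t x =>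
    le_of_tendsto (hS t x).norm
      (Eventually.of_forall fun n => norm_expGroup_apply_le (hA n) (le_max_right _ _) x)
  have hSK : ∀ t y, S t (K y) = K (S t y) := fun t y => by
    refine tendsto_nhds_unique (hS t (K y)) (((K.continuous.tendsto _).comp (hS t y)).congr
      fun n => ?_)
    exact DFunLike.congr_fun (commute_expGroup (commute_yosida K n) (max t 0)) y
  -- convergence along a convergent sequence of initial values
  have hSseq : ∀ t {u : ℕ → H} {x : H}, Tendsto u atTop (𝓝 x) →
      Tendsto (fun n => expGroup (yosida K n) (max t 0) (u n)) atTop (𝓝 (S t x)) := by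
    intro t u x hu
    have h1 : Tendsto (fun n => expGroup (yosida K n) (max t 0) (u n - x)) atTop (𝓝 0) :=
      squeeze_zero_norm (fun n => norm_expGroup_apply_le (hA n) (le_max_right _ _) _)
        (tendsto_iff_norm_sub_tendsto_zero.1 hu)
    have h2 := h1.add (hS t x)
    rw [zero_add] at h2
    exact h2.congr fun n => by rw [← map_add, sub_add_cancel]
  have int_eq : ∀ n x t, 0 ≤ t → expGroup (yosida K n) t x
      = x + ∫ s in (0 : ℝ)..t, expGroup (yosida K n) (max s 0) (yosida K n x) := by
    intro n x t ht
    have hc : Continuous fun s => yosida K n (expGroup (yosida K n) s x) :=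
      (yosida K n).continuous.comp (continuous_expGroup_apply _ x)
    have h := intervalIntegral.integral_eq_sub_of_hasDerivAt
      (fun s _ => hasDerivAt_expGroup_apply (yosida K n) x s) (hc.intervalIntegrable 0 t)
    have h' : ∫ s in (0 : ℝ)..t, expGroup (yosida K n) (max s 0) (yosida K n x)
        = ∫ s in (0 : ℝ)..t, yosida K n (expGroup (yosida K n) s x) := by
      refine intervalIntegral.integral_congr fun s hs => ?_
      rw [uIcc_of_le ht] at hs
      simp only [max_eq_left hs.1]
      exact (DFunLike.congr_fun (commute_expGroup (Commute.refl (yosida K n)) s) x).symm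
    rw [h', h, expGroup_zero]
    simp
  have hSi : ∀ y t, 0 ≤ t → S t (K y) = K y + ∫ s in (0 : ℝ)..t, S s y := by
    intro y t ht
    have hb := tendsto_yosida hK hinj y
    -- A convergent sequence is bounded, and contractivity turns this bound into a constant
    -- dominating function for the integrals.
    obtain ⟨C, hC⟩ := hb.norm.bddAbove_range
    have h := intervalIntegral.tendsto_integral_filter_of_dominated_convergence
      (μ := volume) (a := 0) (b := t) (l := atTop)
      (F := fun n s => expGroup (yosida K n) (max s 0) (yosida K n (K y)))
      (f := fun s => S s y) (fun _ => C)
      (Eventually.of_forall fun n => ((continuous_expGroup_apply (yosida K n) _).comp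
        (continuous_id.max continuous_const)).aestronglyMeasurable)
      (Eventually.of_forall fun n => Eventually.of_forall fun s _ =>
        (norm_expGroup_apply_le (hA n) (le_max_right _ _) _).trans (hC ⟨n, rfl⟩))
      intervalIntegrable_const
      (Eventually.of_forall fun s _ => hSseq s hb)
    have h2 := hS t (K y)
    rw [max_eq_left ht] at h2
    refine tendsto_nhds_unique h2 ((h.const_add (K y)).congr fun n => ?_)
    exact (int_eq n (K y) t ht).symm
  have hS0 : ∀ t ≤ 0, S t = 1 := by
    intro t ht
    ext x
    refine tendsto_nhds_unique (hS t x) ?_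
    simp only [max_eq_right ht, expGroup_zero]
    exact tendsto_const_nhds
  have hSmax : ∀ t, S (max t 0) = S t := by
    intro t
    ext x
    refine tendsto_nhds_unique (hS (max t 0) x) ?_
    simpa using hS t x
  have hScK : ∀ y, Continuous fun t => S t (K y) := by
    intro y
    -- Before the limit, the orbit of K y has speed at most the norm of (K - ε)⁻¹ K y, which tends
    -- to ‖y‖.
    have hii : ∀ a b : ℝ, 0 ≤ a → 0 ≤ b → ‖S b (K y) - S a (K y)‖ ≤ ‖y‖ * |b - a| := by
      intro a b ha hb
      have hb' := tendsto_yosida hK hinj y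
      have h1 := (hS b (K y)).sub (hS a (K y))
      rw [max_eq_left ha, max_eq_left hb] at h1
      refine le_of_tendsto_of_tendsto h1.norm (hb'.norm.mul_const |b - a|)
        (Eventually.of_forall fun n => ?_)
      simp only
      refine (convex_Ici (0 : ℝ)).norm_image_sub_le_of_norm_hasDerivWithin_le
        (f := fun t => expGroup (yosida K n) t (K y))
        (f' := fun t => yosida K n (expGroup (yosida K n) t (K y))) (s := Ici 0)
        (fun s _ => (hasDerivAt_expGroup_apply _ _ s).hasDerivWithinAt) (fun s hs => ?_) ha hb
      have e : yosida K n (expGroup (yosida K n) s (K y))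
          = expGroup (yosida K n) s (yosida K n (K y)) :=
        DFunLike.congr_fun (commute_expGroup (Commute.refl (yosida K n)) s) (K y)
      rw [e]
      exact norm_expGroup_apply_le (hA n) hs _
    have hl : LipschitzWith ‖y‖₊ fun t => S t (K y) := by
      refine LipschitzWith.of_dist_le_mul fun b a => ?_
      rw [dist_eq_norm, ← hSmax a, ← hSmax b]
      refine (hii _ _ (le_max_right _ _) (le_max_right _ _)).trans ?_
      refine mul_le_mul_of_nonneg_left ?_ (norm_nonneg _)
      rw [Real.dist_eq]
      exact abs_max_sub_max_le_abs b a 0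
    exact hl.continuous
  have hSc : ∀ x, Continuous fun t => S t x := by
    intro x
    obtain ⟨u, hu, hux⟩ := mem_closure_iff_seq_limit.1 (denseRange_of_dissipative hK hinj x)
    -- Contractivity makes the approximation by orbits starting in the range of K uniform in t.
    have hunif : TendstoUniformly (fun n t => S t (u n)) (fun t => S t x) atTop := by
      rw [Metric.tendstoUniformly_iff]
      intro r hr
      filter_upwards [Metric.tendsto_nhds.1 hux r hr] with n hn t
      rw [dist_eq_norm, ← map_sub]
      refine (hSn t _).trans_lt ?_
      rwa [← dist_eq_norm, dist_comm]
    refine hunif.continuous (Eventually.frequently (Eventually.of_forall fun n => ?_))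
    obtain ⟨y, hy⟩ := hu n
    rw [← hy]
    exact hScK y
  refine ⟨S, hS0, fun s t hs ht => ?_, hSn, hSc, hSK, hSi⟩
  ext x
  have h1 := hS (s + t) x
  -- In the product exp(sAₙ) exp(tAₙ) x both factors move with n, so convergence along moving
  -- initial values is needed.
  have h2 := hSseq s (hS t x)
  rw [max_eq_left (add_nonneg hs ht)] at h1
  rw [max_eq_left hs, max_eq_left ht] at h2
  refine tendsto_nhds_unique h1 (h2.congr fun n => ?_)
  rw [expGroup_add]
  rfl

/-! ### The abstract Cauchy problem for an operator with a bounded dissipative inverse. -/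

/-- The semigroup and the solutions of the Cauchy problem for an operator with a bounded
dissipative inverse. -/
theorem exists_contractionSemigroup (hK : ∀ y, (inner ℂ (K y) y).re ≤ 0)
    (hinj : Function.Injective K) (T : H →ₗ.[ℂ] H) (hT : ∀ x y, (x, y) ∈ T.graph ↔ x = K y) :
    ∃ S : ℝ → H →L[ℂ] H, IsC0Semigroup S ∧ (∀ t : ℝ, 0 ≤ t → ‖S t‖ ≤ 1) ∧ IsGenerator S T ∧
      ∀ x₀ ∈ T.domain, IsSolution T x₀ (fun t => S t x₀) ∧
        ∀ x : ℝ → H, IsSolution T x₀ x → ∀ t : ℝ, 0 ≤ t → x t = S t x₀ := by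
  obtain ⟨S, hS0, hSadd, hSn, hSc, hSK, hSi⟩ := exists_semigroup_of_inverse hK hinj
  -- The constant extension of S to t < 0 gives a two-sided derivative, at t = 0 too.
  have hd : ∀ y t, HasDerivAt (fun t => K y + ∫ s in (0 : ℝ)..t, S s y) (S t y) t := fun y t =>
    (intervalIntegral.integral_hasDerivAt_right ((hSc y).intervalIntegrable _ _)
      ((hSc y).stronglyMeasurableAtFilter _ _) (hSc y).continuousAt).const_add _
  have hgen : ∀ y, Tendsto (fun t : ℝ => t⁻¹ • (S t (K y) - K y)) (𝓝[>] 0) (𝓝 y) := by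
    intro y
    have h := (hasDerivAt_iff_tendsto_slope_zero.1 (hd y 0)).mono_left
      (nhdsWithin_mono 0 fun t (ht : 0 < t) => ht.ne')
    rw [hS0 0 le_rfl] at h
    refine h.congr' ?_
    filter_upwards [self_mem_nhdsWithin] with t ht
    rw [hSi y t (le_of_lt ht)]
    simp
  have hTd : ∀ y, K y ∈ T.domain := fun y => LinearPMap.mem_domain_iff.2 ⟨y, (hT _ _).2 rfl⟩
  have hTK : ∀ (x : T.domain) y, x.1 = K y → T x = y := fun x y hxy =>
    (T.mem_graph_snd_inj ((hT x.1 y).2 hxy) (T.mem_graph x) rfl).symm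
  have hKT : ∀ x : T.domain, x.1 = K (T x) := fun x => (hT _ _).1 (T.mem_graph x)
  refine ⟨S, ⟨hS0 0 le_rfl, hSadd, fun x => ?_⟩, fun t _ => ?_, fun x y => ⟨fun h => ?_, fun h => ?_⟩,
    fun x₀ hx₀ => ⟨?_, fun x hx t ht => ?_⟩⟩
  · have := ((hSc x).tendsto 0).mono_left (nhdsWithin_le_nhds (s := Ioi 0))
    rwa [hS0 0 le_rfl] at this
  · exact ContinuousLinearMap.opNorm_le_bound _ zero_le_one fun x => by
      rw [one_mul]; exact hSn t x
  · rw [(hT x y).1 h]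
    exact hgen y
  -- Maximality: the generator of S extends T, and 1 - K is onto. With this u, the vector z = x - K
  -- u is sent by the generator to y - u = z. A contraction semigroup admits no such z ≠ 0, because
  -- Re⟨S(t)z - z, z⟩ ≤ 0; hence x = K u and y = u.
  · obtain ⟨u, hu⟩ : ∃ u, u - K u = y - x := by
      have := sub_resolventInv hK one_pos (y - x)
      rw [Complex.ofReal_one, one_smul] at this
      exact ⟨_, this⟩
    have hlim := h.sub (hgen u)
    have hxy : y - u = x - K u := by
      rw [sub_eq_sub_iff_add_eq_add] at hu ⊢
      rw [← hu]; abel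
    have hlim' : Tendsto (fun t : ℝ => t⁻¹ • (S t (x - K u) - (x - K u))) (𝓝[>] 0)
        (𝓝 (x - K u)) := by
      rw [hxy] at hlim
      refine hlim.congr fun t => ?_
      rw [← smul_sub, map_sub]
      congr 1; abel
    have h0 : (inner ℂ (x - K u) (x - K u)).re ≤ 0 := by
      refine le_of_tendsto (Complex.continuous_re.continuousAt.tendsto.comp
        (hlim'.inner (tendsto_const_nhds (x := x - K u)))) ?_
      filter_upwards [self_mem_nhdsWithin] with t ht
      simp only [Function.comp_apply]
      rw [← Complex.coe_smul, inner_smul_left, Complex.conj_ofReal, Complex.re_ofReal_mul,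
        inner_sub_left, Complex.sub_re]
      have e : (inner ℂ (x - K u) (x - K u)).re = ‖x - K u‖ ^ 2 := inner_self_eq_norm_sq (𝕜 := ℂ) _
      have h1 : (inner ℂ (S t (x - K u)) (x - K u)).re ≤ ‖S t (x - K u)‖ * ‖x - K u‖ :=
        re_inner_le_norm (𝕜 := ℂ) _ _
      have h2 := mul_le_mul_of_nonneg_right (hSn t (x - K u)) (norm_nonneg (x - K u))
      have ht' : 0 < t⁻¹ := inv_pos.2 ht
      rw [e]
      exact mul_nonpos_of_nonneg_of_nonpos ht'.le (by nlinarith)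
    have e : (inner ℂ (x - K u) (x - K u)).re = ‖x - K u‖ ^ 2 := inner_self_eq_norm_sq (𝕜 := ℂ) _
    rw [e] at h0
    have hz : x - K u = 0 :=
      norm_eq_zero.1 (pow_eq_zero_iff two_ne_zero |>.1 (le_antisymm h0 (sq_nonneg _)))
    rw [hT]
    rw [hz] at hxy
    rw [sub_eq_zero.1 hxy, sub_eq_zero.1 hz]
  · obtain ⟨y, rfl⟩ : ∃ y, x₀ = K y := ⟨T ⟨x₀, hx₀⟩, hKT ⟨x₀, hx₀⟩⟩
    have hmem : ∀ t, S t (K y) ∈ T.domain := fun t => by rw [hSK]; exact hTd _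
    have happ : ∀ t, T ⟨S t (K y), hmem t⟩ = S t y := fun t => hTK _ _ (hSK t y)
    -- The integral formula for the orbit is available only for nonnegative times, so it is used
    -- near a positive t.
    have hev : ∀ t, 0 < t →
        (fun t => S t (K y)) =ᶠ[𝓝 t] fun t => K y + ∫ s in (0 : ℝ)..t, S s y := fun t ht => by
      filter_upwards [lt_mem_nhds ht] with s hs using hSi y s hs.le
    refine ⟨?_, fun t _ => hmem t, (hSc _).continuousOn, ?_, ?_, fun t ht => ?_⟩
    · simp [hS0 0 le_rfl]
    · simp only [happ]
      exact (hSc y).comp continuous_subtype_val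
    · have hC1 : ContDiff ℝ 1 fun t => K y + ∫ s in (0 : ℝ)..t, S s y := by
        rw [contDiff_one_iff_deriv]
        refine ⟨fun t => (hd y t).differentiableAt, ?_⟩
        rw [show deriv (fun t => K y + ∫ s in (0 : ℝ)..t, S s y) = fun t => S t y from
          funext fun t => (hd y t).deriv]
        exact hSc y
      exact hC1.contDiffOn.congr fun t ht => hSi y t (le_of_lt ht)
    · rw [happ]
      exact (hd y t).congr_of_eventuallyEq (hev t ht)
  · obtain ⟨y, rfl⟩ : ∃ y, x₀ = K y := ⟨T ⟨x₀, hx₀⟩, hKT ⟨x₀, hx₀⟩⟩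
    -- Uniqueness: the difference z of two solutions satisfies z = K z', so Re⟨z', z⟩ = Re⟨K z', z'⟩
    -- ≤ 0 and ‖z‖ cannot grow from 0.
    have hz : ∀ t (ht : 0 < t), HasDerivAt (fun t => x t - S t (K y))
        (T ⟨x t, hx.mem_domain t ht.le⟩ - S t y) t := fun t ht =>
      (hx.hasDerivAt t ht).sub ((hd y t).congr_of_eventuallyEq (by
        filter_upwards [lt_mem_nhds ht] with s hs using hSi y s hs.le))
    have h := norm_le_of_re_inner_nonpos (u := fun t => x t - S t (K y))
      (u' := fun t => deriv (fun t => x t - S t (K y)) t)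
      (hx.continuousOn.sub (hSc _).continuousOn) (fun t ht => by
        rw [(hz t ht).deriv]; exact hz t ht) (fun t ht => by
        rw [(hz t ht).deriv]
        have e : x t - S t (K y) = K (T ⟨x t, hx.mem_domain t ht.le⟩ - S t y) := by
          rw [map_sub, ← hKT ⟨x t, hx.mem_domain t ht.le⟩, hSK]
        rw [e]
        refine le_trans (le_of_eq ?_) (hK (T ⟨x t, hx.mem_domain t ht.le⟩ - S t y))
        exact inner_re_symm (𝕜 := ℂ) _ _) ht
    rw [hx.initial, hS0 0 le_rfl, one_apply_eq_self, sub_self,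
      norm_zero] at h
    exact sub_eq_zero.1 (norm_le_zero_iff.1 h)

end Dissipative


/-! ### Green's identity and regularity on a single edge -/

lemma hasWeakDeriv_iterate {m n : ℕ} {f : L2} (hf : f ∈ sobolev m) (h : n < m) :
    HasWeakDeriv (weakDeriv^[n] f) (weakDeriv^[n + 1] f) := by
  rw [Function.iterate_succ_apply']
  exact hasWeakDeriv_of_mem (iterate_weakDeriv_mem n (m := 0 + 1)
    (sobolev_antitone (by omega) hf))

/-- Two integrations by parts for the fourth-order term and one for the second-order term. At 1 the
boundary terms vanish because φ(1) = 0 and u''(1) = 0. -/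
lemma green {u φ : L2} (hu : u ∈ sobolev 4) (hφ : φ ∈ sobolevStar 2)
    (hu1 : pointValue (weakDeriv^[2] u) 1 = 0) (δ : ℂ) :
    inner ℂ (weakDeriv^[2] φ) (weakDeriv^[2] u) + δ * inner ℂ (weakDeriv φ) (weakDeriv u)
      + inner ℂ φ (-weakDeriv^[4] u + δ • weakDeriv^[2] u)
    = (starRingEnd ℂ) (pointValue φ 0)
        * (pointValue (weakDeriv^[3] u) 0 - δ * pointValue (weakDeriv u) 0)
      - (starRingEnd ℂ) (pointValue (weakDeriv φ) 0) * pointValue (weakDeriv^[2] u) 0 := by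
  have f0 : HasWeakDeriv φ (weakDeriv φ) := hasWeakDeriv_iterate hφ.1 two_pos
  have f1 : HasWeakDeriv (weakDeriv φ) (weakDeriv^[2] φ) := hasWeakDeriv_iterate hφ.1 one_lt_two
  have u1 : HasWeakDeriv (weakDeriv u) (weakDeriv^[2] u) :=
    hasWeakDeriv_iterate (n := 1) hu (by norm_num)
  have u2 := hasWeakDeriv_iterate (n := 2) hu (by norm_num)
  have u3 := hasWeakDeriv_iterate (n := 3) hu (by norm_num)
  have e1 := f1.inner_add_inner u2
  have e2 := f0.inner_add_inner u3
  have e3 := f0.inner_add_inner u1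
  rw [hφ.2.2, map_zero] at e2 e3
  rw [hu1] at e1
  rw [inner_add_right, inner_neg_right, inner_smul_right]
  linear_combination e1 - e2 + δ * e3

lemma exists_hasWeakDeriv_of_value_one (g : L2) : ∃ f, HasWeakDeriv f g ∧ pointValue f 1 = 0 := by
  obtain ⟨f, hf, h0⟩ := exists_hasWeakDeriv g (-(inner ℂ oneL2 g))
  refine ⟨f, hf, ?_⟩
  have := hf.inner_oneL2
  rw [h0] at this
  linear_combination -this

lemma inner_rampL2_self_ne_zero : inner ℂ rampL2 rampL2 ≠ 0 := by
  rw [inner_self_ne_zero]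
  intro h
  have := pointValue_rampL2 zero_mem_unit
  rw [h, pointValue_zero zero_mem_unit] at this
  simp at this

/-- A class orthogonal to all `φ''`, where `φ` vanishes at both end points and `φ'` at `0`, is a
multiple of `1 - s`. -/
lemma eq_smul_rampL2 {z : L2} (h : ∀ φ φ' φ'' : L2, HasWeakDeriv φ φ' → HasWeakDeriv φ' φ'' →
    pointValue φ 0 = 0 → pointValue φ' 0 = 0 → pointValue φ 1 = 0 → inner ℂ φ'' z = 0) :
    ∃ c : ℂ, z = c • rampL2 := by
  set c := inner ℂ rampL2 z / inner ℂ rampL2 rampL2 with hc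
  refine ⟨c, ?_⟩
  set r := z - c • rampL2 with hr
  have hor : inner ℂ rampL2 r = 0 := by
    rw [hr, inner_sub_right, inner_smul_right, hc, div_mul_cancel₀ _ inner_rampL2_self_ne_zero,
      sub_self]
  -- The residual r is itself an admissible second derivative: integrating it twice from 0 gives φ
  -- with φ(1) = ⟨1 - s, r⟩ = 0. So r is orthogonal to z and to 1 - s, hence to itself.
  obtain ⟨φ', h1, h1'⟩ := exists_hasWeakDeriv r 0
  obtain ⟨φ, h0, h0'⟩ := exists_hasWeakDeriv φ' 0
  have e1 := h1.inner_rampL2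
  rw [hor, h1', h0.inner_oneL2, h0'] at e1
  have e2 := h φ φ' r h0 h1 h0' h1' (by linear_combination -e1)
  have e3 : inner ℂ r rampL2 = 0 := by rw [← inner_conj_symm, hor, map_zero]
  have e4 : inner ℂ r r = 0 := by
    nth_rewrite 2 [hr]
    rw [inner_sub_right, inner_smul_right, e2, e3, mul_zero, sub_zero]
  exact sub_eq_zero.1 (inner_self_eq_zero.1 e4)

/-- Interior regularity and the natural boundary condition at `1` for weak solutions of
`-w⁗ + δ w'' = G`. -/
lemma regularity {w G : L2} {δ : ℂ} (hw : w ∈ sobolev 2)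
    (h : ∀ φ ∈ sobolevStar 2, pointValue φ 0 = 0 → pointValue (weakDeriv φ) 0 = 0 →
      inner ℂ (weakDeriv^[2] φ) (weakDeriv^[2] w) + δ * inner ℂ (weakDeriv φ) (weakDeriv w)
        = -inner ℂ φ G) :
    w ∈ sobolev 4 ∧ pointValue (weakDeriv^[2] w) 1 = 0 ∧
      -weakDeriv^[4] w + δ • weakDeriv^[2] w = G := by
  have w0 : HasWeakDeriv w (weakDeriv w) := hasWeakDeriv_iterate hw two_pos
  have w1 : HasWeakDeriv (weakDeriv w) (weakDeriv^[2] w) := hasWeakDeriv_iterate hw one_lt_two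
  obtain ⟨p, hp, -⟩ := exists_hasWeakDeriv G 0
  -- By construction r'' = δ w'' - G and r(1) = 0. The weak identity makes w'' - r orthogonal to all
  -- admissible φ'', so w'' = r + c(1 - s). Adding c(1 - s) changes neither the second derivative
  -- nor the zero at 1.
  obtain ⟨r, hr, hr1⟩ := exists_hasWeakDeriv_of_value_one (δ • weakDeriv w + (-1 : ℂ) • p)
  have hr' := (w1.smul δ).add (hp.smul (-1))
  obtain ⟨c, hc⟩ : ∃ c : ℂ, weakDeriv^[2] w - r = c • rampL2 := by
    refine eq_smul_rampL2 fun φ φ' φ'' f0 f1 h0 h0' h1 => ?_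
    have hφ : φ ∈ sobolevStar 2 := ⟨⟨φ', ⟨φ'', trivial, f1⟩, f0⟩, ⟨φ', trivial, f0⟩, h1⟩
    have e0 : weakDeriv φ = φ' := f0.weakDeriv_eq
    have e1 : weakDeriv^[2] φ = φ'' := by
      change weakDeriv (weakDeriv φ) = _
      rw [e0, f1.weakDeriv_eq]
    have e := h φ hφ h0 (by rw [e0, h0'])
    rw [e0, e1] at e
    have i1 := f1.inner_add_inner hr
    have i2 := f0.inner_add_inner hp
    rw [hr1, h0', map_zero] at i1
    rw [h0, h1, map_zero] at i2
    simp only [inner_add_right, inner_smul_right] at i1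
    rw [inner_sub_right]
    linear_combination e - i1 - i2
  have hw2 : weakDeriv^[2] w = r + c • rampL2 := by rw [← hc]; abel
  have w2 : HasWeakDeriv (weakDeriv^[2] w)
      (δ • weakDeriv w + (-1 : ℂ) • p + c • -oneL2) := by
    rw [hw2]; exact hr.add (hasWeakDeriv_rampL2.smul c)
  have w3 : HasWeakDeriv (δ • weakDeriv w + (-1 : ℂ) • p + c • -oneL2)
      (δ • weakDeriv^[2] w + (-1 : ℂ) • G) := by
    have := (hr'.add (hasWeakDeriv_oneL2.smul (-c)))
    rw [smul_zero, add_zero] at this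
    rwa [smul_neg, ← neg_smul]
  refine ⟨⟨_, ⟨_, ⟨_, ⟨_, trivial, w3⟩, w2⟩, w1⟩, w0⟩, ?_, ?_⟩
  · rw [hw2, pointValue_add ⟨_, trivial, hr⟩
      (Submodule.smul_mem _ c ⟨_, trivial, hasWeakDeriv_rampL2⟩) one_mem_unit,
      pointValue_smul c ⟨_, trivial, hasWeakDeriv_rampL2⟩ one_mem_unit,
      pointValue_rampL2 one_mem_unit, hr1]
    simp
  · change -weakDeriv (weakDeriv (weakDeriv^[2] w)) + _ = _
    rw [w2.weakDeriv_eq, w3.weakDeriv_eq]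
    module

lemma exists_sobolevStar_two (a b : ℂ) :
    ∃ φ ∈ sobolevStar 2, pointValue φ 0 = a ∧ pointValue (weakDeriv φ) 0 = b := by
  have hs : ∀ s : ℝ, HasDerivAt (fun s : ℝ => (s : ℂ)) 1 s := fun s =>
    Complex.ofRealCLM.hasDerivAt
  -- The polynomial a + bs - (a + b)s² has the prescribed data at 0 and vanishes at 1.
  have d0 : ∀ s : ℝ, HasDerivAt (fun s : ℝ => a + b * s - (a + b) * (s : ℂ) ^ 2)
      (b - 2 * (a + b) * s) s := fun s => by
    refine ((((hs s).const_mul b).const_add a).sub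
      (((hs s).pow 2).const_mul (a + b))).congr_deriv ?_
    push_cast
    ring
  have d1 : ∀ s : ℝ, HasDerivAt (fun s : ℝ => b - 2 * (a + b) * s) (-(2 * (a + b))) s :=
    fun s => (((hs s).const_mul (2 * (a + b))).const_sub b).congr_deriv (by ring)
  have f0 := hasWeakDeriv_ofContinuousOn d0 (by fun_prop)
  have f1 := hasWeakDeriv_ofContinuousOn d1 continuous_const
  refine ⟨_, ⟨⟨_, ⟨_, trivial, f1⟩, f0⟩, ⟨_, trivial, f0⟩, ?_⟩, ?_, ?_⟩
  · rw [pointValue_ofContinuousOn _ one_mem_unit]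
    simp
  · rw [pointValue_ofContinuousOn _ zero_mem_unit]
    simp
  · rw [f0.weakDeriv_eq, pointValue_ofContinuousOn _ zero_mem_unit]
    simp

/-! ### The bounded inverse of the system operator -/

open StateSpace

variable {P : Params}

/-- The inverse of `𝒯`. -/
def inverseT (P : Params) : StateSpace P →L[ℂ] StateSpace P :=
  ∑ k, ((velocity k).adjoint ∘L displacement k
    - (displacement k).adjoint ∘L (velocity k + ((2 * P.β * P.η : ℝ) : ℂ) • StateSpace.slope k)
    - (P.κ : ℂ) • ((slopeZero k).adjoint ∘L slopeZero k)
    - ((P.β * P.η : ℝ) : ℂ) • ((displacementZero k).adjoint ∘L displacementZero k))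

lemma inner_inverseT (x y : StateSpace P) : inner ℂ x (inverseT P y) =
    ∑ k, (inner ℂ (x.v k) (y.w k)
      - inner ℂ (x.w k) (y.v k + ((2 * P.β * P.η : ℝ) : ℂ) • weakDeriv (y.w k))
      - P.κ * ((starRingEnd ℂ) (pointValue (weakDeriv (x.w k)) 0)
        * pointValue (weakDeriv (y.w k)) 0)
      - (P.β * P.η : ℝ) * ((starRingEnd ℂ) (pointValue (x.w k) 0) * pointValue (y.w k) 0)) := by
  rw [inverseT, _root_.sum_apply, inner_sum]
  refine Finset.sum_congr rfl fun k _ => ?_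
  simp only [_root_.sub_apply, _root_.smul_apply, _root_.add_apply,
    ContinuousLinearMap.comp_apply, inner_sub_right, inner_smul_right,
    ContinuousLinearMap.adjoint_inner_right, velocity_apply, displacement_apply, slope_apply,
    slopeZero_apply, displacementZero_apply, RCLike.inner_apply]
  ring

/-- The pairings of w with v cancel in the real part. Since w(1) = 0, 2 Re⟨w, w'⟩ = -|w(0)|², so the
transport term cancels the vertex term and only -κ |w'(0)|² is left on each edge. -/
lemma re_inner_inverseT_le (y : StateSpace P) : (inner ℂ (inverseT P y) y).re ≤ 0 := by
  have hs : (inner ℂ (inverseT P y) y).re = (inner ℂ y (inverseT P y)).re :=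
    inner_re_symm (𝕜 := ℂ) (inverseT P y) y
  rw [hs, inner_inverseT, Complex.re_sum]
  refine Finset.sum_nonpos fun k _ => ?_
  have e1 : (inner ℂ (y.v k) (y.w k)).re = (inner ℂ (y.w k) (y.v k)).re :=
    inner_re_symm (𝕜 := ℂ) _ _
  have e2 : (inner ℂ (weakDeriv (y.w k)) (y.w k)).re = (inner ℂ (y.w k) (weakDeriv (y.w k))).re :=
    inner_re_symm (𝕜 := ℂ) _ _
  have e3 := congrArg Complex.re ((hasWeakDeriv_w y k).inner_add_inner (hasWeakDeriv_w y k))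
  rw [(y.w_mem.1 k).2.2, mul_zero] at e3
  have e4 : ∀ z : ℂ, (starRingEnd ℂ) z * z = ((‖z‖ ^ 2 : ℝ) : ℂ) := fun z => by
    rw [mul_comm, Complex.mul_conj, Complex.normSq_eq_norm_sq]
  simp only [e4, Complex.add_re, Complex.sub_re, Complex.ofReal_re, e2,
    Complex.zero_re] at e3
  simp only [e4, inner_add_right, inner_smul_right, Complex.sub_re, Complex.add_re,
    Complex.re_ofReal_mul, Complex.ofReal_re, e1]
  have h5 : 0 ≤ P.κ * ‖pointValue (weakDeriv (y.w k)) 0‖ ^ 2 :=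
    mul_nonneg P.κ_nonneg (sq_nonneg _)
  linear_combination (-P.β * P.η) * e3 + h5

/-! ### `inverseT` as a left inverse of the system operator. -/

lemma inverseT_opT (x : (opT P).domain) : inverseT P (opT P x) = x.1 := by
  obtain ⟨a1, a2, a3, a4, a5⟩ : x.1 ∈ (opA P).domain := opT_domain P ▸ x.2
  refine ext_inner_left ℂ fun φ => ?_
  rw [inner_inverseT, inner_def, ← Finset.sum_add_distrib]
  rw [← sub_eq_zero, ← Finset.sum_sub_distrib]
  -- All three φₖ(0) equal φ₀(0). After Green's identity and the moment condition at 0, this common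
  -- factor multiplies the vertex sum, which vanishes.
  refine (Finset.sum_congr rfl (g := fun k => -((starRingEnd ℂ) (pointValue (φ.w 0) 0) *
      (pointValue (weakDeriv^[3] (x.1.w k)) 0
          - (P.γ - P.η ^ 2) * pointValue (weakDeriv (x.1.w k)) 0
          + P.β * P.η * pointValue (x.1.v k) 0))) fun k _ => ?_).trans ?_
  · have hg := green (a1 k) (φ.w_mem.1 k) (a3 k) ((P.γ - P.η ^ 2 : ℝ) : ℂ)
    -- The first component of T x is v, so adding 2βη times its derivative cancels the contribution
    -- of ℬ.
    have hv : (opT P x).v k + ((2 * P.β * P.η : ℝ) : ℂ) • weakDeriv ((opT P x).w k)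
        = -weakDeriv^[4] (x.1.w k) + ((P.γ - P.η ^ 2 : ℝ) : ℂ) • weakDeriv^[2] (x.1.w k) := by
      rw [opT_apply_v, opT_apply_w, add_assoc, ← add_smul]
      simp
    rw [hv, opT_apply_w]
    rw [φ.w_mem.2 k 0] at hg ⊢
    have h4 := a4 k
    push_cast at hg ⊢
    linear_combination -hg + (starRingEnd ℂ) (pointValue (weakDeriv (φ.w k)) 0) * h4
  · rw [Finset.sum_neg_distrib, ← Finset.mul_sum, a5, mul_zero, neg_zero]

/-! ### `inverseT` as a right inverse: weak form, regularity and boundary conditions. -/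

lemma inverseT_v (y : StateSpace P) : (inverseT P y).v = y.w := by
  funext k
  refine ext_inner_left ℂ fun h => ?_
  have e := inner_inverseT (StateSpace.mk 0 (Pi.single k h) (zero_mem _)) y
  have e2 : weakDeriv^[2] 0 = 0 := iterate_weakDeriv_zero 2
  rw [inner_def] at e
  simp only [w_mk, v_mk, Pi.zero_apply, e2, weakDeriv_zero, pointValue_zero zero_mem_unit,
    inner_zero_left, map_zero, mul_zero, zero_mul, add_zero, sub_zero,
    Finset.sum_const_zero, zero_add] at e
  rw [Finset.sum_eq_single k, Finset.sum_eq_single k] at e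
  · simpa using e
  all_goals simp +contextual

/-- Obtained by pairing with (φ, 0): the variational formulation of T(w, v) = y, with all vertex
conditions encoded in the boundary terms. -/
lemma weak_form_inverseT (y : StateSpace P) {φ : Fin 3 → L2} (hφ : φ ∈ H2StarG) :
    ∑ k, (inner ℂ (weakDeriv^[2] (φ k)) (weakDeriv^[2] ((inverseT P y).w k))
        + ((P.γ - P.η ^ 2 : ℝ) : ℂ) * inner ℂ (weakDeriv (φ k)) (weakDeriv ((inverseT P y).w k))
        + inner ℂ (φ k) (y.v k + ((2 * P.β * P.η : ℝ) : ℂ) • weakDeriv (y.w k))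
        + (starRingEnd ℂ) (pointValue (weakDeriv (φ k)) 0)
          * (P.α * pointValue (weakDeriv ((inverseT P y).w k)) 0
            + P.κ * pointValue (weakDeriv (y.w k)) 0)
        + (starRingEnd ℂ) (pointValue (φ k) 0) * (P.β * P.η * pointValue (y.w k) 0)) = 0 := by
  have e := inner_inverseT (StateSpace.mk φ 0 hφ) y
  rw [inner_def, ← Finset.sum_add_distrib, ← sub_eq_zero, ← Finset.sum_sub_distrib] at e
  rw [← e]
  refine Finset.sum_congr rfl fun k _ => ?_
  simp only [w_mk, v_mk, Pi.zero_apply, inner_zero_left]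
  push_cast
  ring

/-- A test function vanishing at the inner vertex may live on one edge only; this decouples the
edges. -/
lemma single_mem_H2StarG (k : Fin 3) {φ : L2} (hφ : φ ∈ sobolevStar 2)
    (h0 : pointValue φ 0 = 0) : (Pi.single k φ : Fin 3 → L2) ∈ H2StarG := by
  have hz : ∀ j, pointValue ((Pi.single k φ : Fin 3 → L2) j) 0 = 0 := fun j => by
    by_cases h : j = k
    · subst h; simpa using h0
    · rw [Pi.single_eq_of_ne h, pointValue_zero zero_mem_unit]
  refine ⟨fun j => ?_, fun i j => by rw [hz, hz]⟩
  by_cases h : j = k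
  · subst h; simpa using hφ
  · rw [Pi.single_eq_of_ne h]; exact zero_mem _

lemma weak_form_inverseT_single (y : StateSpace P) (k : Fin 3) {φ : L2} (hφ : φ ∈ sobolevStar 2)
    (h0 : pointValue φ 0 = 0) :
    inner ℂ (weakDeriv^[2] φ) (weakDeriv^[2] ((inverseT P y).w k))
        + ((P.γ - P.η ^ 2 : ℝ) : ℂ) * inner ℂ (weakDeriv φ) (weakDeriv ((inverseT P y).w k))
        + inner ℂ φ (y.v k + ((2 * P.β * P.η : ℝ) : ℂ) • weakDeriv (y.w k))
        + (starRingEnd ℂ) (pointValue (weakDeriv φ) 0)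
          * (P.α * pointValue (weakDeriv ((inverseT P y).w k)) 0
            + P.κ * pointValue (weakDeriv (y.w k)) 0) = 0 := by
  have e := weak_form_inverseT y (single_mem_H2StarG k hφ h0)
  rw [Finset.sum_eq_single k] at e
  · simpa only [Pi.single_eq_same, h0, map_zero, zero_mul, add_zero] using e
  · intro j _ hj
    have e2 : weakDeriv^[2] 0 = 0 := iterate_weakDeriv_zero 2
    simp only [Pi.single_eq_of_ne hj, e2, weakDeriv_zero, pointValue_zero zero_mem_unit,
      inner_zero_left, map_zero, zero_mul, mul_zero, add_zero]
  · simp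

lemma regularity_inverseT (y : StateSpace P) (k : Fin 3) :
    (inverseT P y).w k ∈ sobolev 4 ∧ pointValue (weakDeriv^[2] ((inverseT P y).w k)) 1 = 0 ∧
      -weakDeriv^[4] ((inverseT P y).w k)
        + ((P.γ - P.η ^ 2 : ℝ) : ℂ) • weakDeriv^[2] ((inverseT P y).w k)
        = y.v k + ((2 * P.β * P.η : ℝ) : ℂ) • weakDeriv (y.w k) := by
  refine regularity ((inverseT P y).w_mem_sobolev_two k) fun φ hφ h0 h0' => ?_
  have e := weak_form_inverseT_single y k hφ h0
  rw [h0', map_zero, zero_mul] at e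
  linear_combination e

lemma inverseT_mem_domain (y : StateSpace P) : inverseT P y ∈ (opA P).domain := by
  have hreg := regularity_inverseT y
  refine ⟨fun k => (hreg k).1, ?_, fun k => (hreg k).2.1, fun k => ?_, ?_⟩
  · rw [inverseT_v]; exact y.w_mem
  -- With φ(0) = 0 and φ'(0) = 1, comparing the weak form with Green's identity leaves exactly the
  -- moment condition on one edge.
  · obtain ⟨φ, hφ, h0, h1⟩ := exists_sobolevStar_two 0 1
    have e := weak_form_inverseT_single y k hφ h0
    have g := green (hreg k).1 hφ (hreg k).2.1 ((P.γ - P.η ^ 2 : ℝ) : ℂ)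
    rw [(hreg k).2.2, h0, h1, map_zero, zero_mul, map_one] at g
    rw [h1, map_one] at e
    rw [inverseT_v]
    linear_combination g - e
  -- The same φ on all edges, with φ(0) = 1 and φ'(0) = 0, is continuous at the vertex and isolates
  -- the force balance there.
  · obtain ⟨φ, hφ, h0, h1⟩ := exists_sobolevStar_two 1 0
    have e := weak_form_inverseT y (φ := fun _ => φ) ⟨fun _ => hφ, fun _ _ => rfl⟩
    rw [← e]
    refine Finset.sum_congr rfl fun k _ => ?_
    have g := green (hreg k).1 hφ (hreg k).2.1 ((P.γ - P.η ^ 2 : ℝ) : ℂ)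
    rw [(hreg k).2.2] at g
    rw [g, h0, h1, inverseT_v]
    simp

lemma mem_graph_opT_iff (x y : StateSpace P) : (x, y) ∈ (opT P).graph ↔ x = inverseT P y := by
  rw [LinearPMap.mem_graph_iff]
  constructor
  · rintro ⟨z, rfl, rfl⟩
    exact (inverseT_opT z).symm
  · rintro rfl
    refine ⟨⟨inverseT P y, by rw [opT_domain]; exact inverseT_mem_domain y⟩, rfl, ?_⟩
    refine StateSpace.ext ?_ (funext fun k => ?_)
    · rw [opT_apply_w]; exact inverseT_v y
    · rw [opT_apply_v, (regularity_inverseT y k).2.2, inverseT_v, add_assoc, ← add_smul]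
      simp

/-- If K y = K y', both (K y, y) and (K y, y') lie on the graph of T, which is single-valued. -/
lemma inverseT_injective : Function.Injective (inverseT P) := fun _ _ h =>
  (opT P).mem_graph_snd_inj ((mem_graph_opT_iff _ _).2 rfl) ((mem_graph_opT_iff _ _).2 rfl) h

end PipeNetwork

end

theorem theorem2p1 (P : PipeNetwork.Params) :
    ∃ S : ℝ → PipeNetwork.StateSpace P →L[ℂ] PipeNetwork.StateSpace P,
      PipeNetwork.IsC0Semigroup S ∧
      (∀ t : ℝ, 0 ≤ t → ‖S t‖ ≤ 1) ∧
      PipeNetwork.IsGenerator S (PipeNetwork.opT P) ∧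
      ∀ x₀ ∈ (PipeNetwork.opA P).domain,
        PipeNetwork.IsSolution (PipeNetwork.opT P) x₀ (fun t => S t x₀) ∧
        ∀ x : ℝ → PipeNetwork.StateSpace P, PipeNetwork.IsSolution (PipeNetwork.opT P) x₀ x →
          ∀ t : ℝ, 0 ≤ t → x t = S t x₀ := by
  rw [← PipeNetwork.opT_domain]
  exact PipeNetwork.exists_contractionSemigroup PipeNetwork.re_inner_inverseT_le
    PipeNetwork.inverseT_injective (PipeNetwork.opT P) PipeNetwork.mem_graph_opT_iff
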